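/- Let $\mathbf{Gpd}$ be the category of small groupoids and functors. For a functor $F:A\to B$ between groupoids let $MF$ be the groupoid whose objects are pairs $(a,\,x:b\cong Fa)$ with $a\in A$ and $x$ an isomorphism in $B$, and whose arrows $(a,x:b\cong Fa)\to(a',x':b'\cong Fa')$ are pairs of arrows $\beta:b\to b'$, $\alpha:a\to a'$ with $x'\beta=F(\alpha)\,x$. The factorisation $F=(RF)(LF)$ with $LF:A\to MF$, $a\mapsto(a,\mathrm{id}_{Fa})$, and $RF:MF\to B$, $(a,x:b\cong Fa)\mapsto b$, together with the comultiplication $\Delta_F:MF\to M(LF)$, $\Delta_F(a,x)=(a,(x,\mathrm{id}_a):(a,x)\cong (LF)a)$, and the multiplication $\mu_F:M(RF)\to MF$, $\mu_F((a,x),x')=(a,xx')$, is an algebraic weak factorisation system on $\mathbf{Gpd}$. Let $R\text{-}\mathbf{Alg}$ be the category of algebras for its monad $R$ on the arrow category $\mathbf{Gpd}^{\mathbf 2}$, and let $S:R\text{-}\mathbf{Alg}\to\mathbf{Gpd}$ send an algebra on $F:A\to B$ to $B$. Call a functor $p:\mathbf E\to\mathbf B$ an elementary fibration if it is a fibration;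 $\mathbf B$ and all fibres $\mathbf E_X$ have finite products, and reindexing preserves the finite products of the fibres; for all objects $Y,X$ of $\mathbf B$, reindexing along the parametrised diagonal $\delta_{Y,X}=\langle \mathrm{pr}_1,\mathrm{pr}_2,\mathrm{pr}_2\rangle:Y\times X\to Y\times X\times X$ has a left adjoint $\Sigma_{Y,X}$; and these left adjoints satisfy * Frobenius Reciprocity: for all $A$ over $Y\times X$ and $C$ over $Y\times X\times X$ the canonical arrow $\Sigma_{Y,X}(\delta_{Y,X}^*C\wedge A)\to C\wedge\Sigma_{Y,X}A$ is an isomorphism; * the Beck–Chevalley Condition: for all $f:Y\to Z$ and all $A$ over $Z\times X$ the canonical arrow $\Sigma_{Y,X}(f\times X)^*A\to(f\times X\times X)^*\Sigma_{Z,X}A$ is an isomorphism. Then: 1. $S:R\text{-}\mathbf{Alg}\to\mathbf{Gpd}$ is an elementary fibration. 2. The algebras are the split cloven isofibrations: $R\text{-}\mathbf{Alg}$ is equivalent, strictly over $\mathbf{Gpd}^{\mathbf 2}$ (hence over $\mathbf{Gpd}$), to the category whose objects are functors $F:A\to B$ between groupoids equipped with a choice, for each $a\in A$ and isomorphism $x:b\cong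 Fa$, of an arrow into $a$ over $x$, such that the chosen lifts of identities are identities and the chosen lifts of composites are the composites of the chosen lifts, and whose arrows are the commutative squares preserving the chosen lifts strictly. -/

import Mathlib

open CategoryTheory Limits

universe u

namespace ElemFib

section Reindexing

universe v₁ v₂ u₁ u₂

variable {B : Type u₁} {E : Type u₂} [Category.{v₁} B] [Category.{v₂} E]
  (p : E ⥤ B) [p.IsFibered]

/-- The reindexed object `f^* A` of `A` along `f`, for a chosen cleavage of the fibration `p`. -/
noncomputable def reindexObj {X Y : B} (f : X ⟶ Y) (A : p.Fiber Y) : p.Fiber X :=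
  ⟨Functor.IsPreFibered.pullbackObj A.2 f, Functor.IsPreFibered.pullbackObj_proj A.2 f⟩

/-- The chosen cartesian lift `f^* A ⟶ A` of `f` into `A`. -/
noncomputable def cartLift {X Y : B} (f : X ⟶ Y) (A : p.Fiber Y) : (reindexObj p f A).1 ⟶ A.1 :=
  Functor.IsPreFibered.pullbackMap A.2 f

instance cartLift_isCartesian {X Y : B} (f : X ⟶ Y) (A : p.Fiber Y) :
    p.IsCartesian f (cartLift p f A) :=
  Functor.IsPreFibered.pullbackMap.IsCartesian A.2 f

/-- The vertical arrow `C ⟶ f^* A` induced by an arrow `C ⟶ A` over `f`. -/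
noncomputable def vertLift {X Y : B} (f : X ⟶ Y) {C : p.Fiber X} {A : p.Fiber Y}
    (φ : C.1 ⟶ A.1) (hφ : p.IsHomLift f φ) : C ⟶ reindexObj p f A :=
  ⟨Functor.IsCartesian.map p f (cartLift p f A) φ, inferInstance⟩

theorem vertLift_fac {X Y : B} (f : X ⟶ Y) {C : p.Fiber X} {A : p.Fiber Y}
    (φ : C.1 ⟶ A.1) (hφ : p.IsHomLift f φ) : (vertLift p f φ hφ).1 ≫ cartLift p f A = φ :=
  Functor.IsCartesian.fac p f (cartLift p f A) φ

theorem vert_ext {X Y : B} (f : X ⟶ Y) {C : p.Fiber X} {A : p.Fiber Y}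
    {φ ψ : C ⟶ reindexObj p f A} (h : φ.1 ≫ cartLift p f A = ψ.1 ≫ cartLift p f A) : φ = ψ := by
  have := φ.2
  have := ψ.2
  exact Subtype.ext (Functor.IsCartesian.ext p f (cartLift p f A) φ.1 ψ.1 h)

theorem isHomLift_cartLift_comp {X Y : B} (f : X ⟶ Y) {A A' : p.Fiber Y} (φ : A ⟶ A') :
    p.IsHomLift f (cartLift p f A ≫ φ.1) := by
  have := φ.2
  exact IsHomLift.comp_lift_id_right p f (cartLift p f A) φ.1

/-- The reindexing functor `f^* : E_Y ⥤ E_X` between the fibres, for the chosen cleavage. -/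
noncomputable def reindex {X Y : B} (f : X ⟶ Y) : p.Fiber Y ⥤ p.Fiber X where
  obj A := reindexObj p f A
  map {A A'} φ := vertLift p f (cartLift p f A ≫ φ.1) (isHomLift_cartLift_comp p f φ)
  map_id A := by
    apply vert_ext
    rw [vertLift_fac]
    change _ ≫ 𝟙 _ = 𝟙 _ ≫ _
    simp
  map_comp {A A' A''} φ ψ := by
    apply vert_ext
    rw [vertLift_fac]
    change cartLift p f A ≫ φ.1 ≫ ψ.1 = ((vertLift p f _ _).1 ≫ (vertLift p f _ _).1) ≫ _
    rw [Category.assoc, vertLift_fac, ← Category.assoc, ← Category.assoc, vertLift_fac]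

/-- The arrow `f^* g^* A ⟶ g'^* A` over `f'` attached to a commutative square `f ≫ g = f' ≫ g'`:
the factorisation of `f^* g^* A ⟶ g^* A ⟶ A` through the cartesian lift `g'^* A ⟶ A`. -/
noncomputable def reindexCommAux {X Y Y' Z : B} {f : X ⟶ Y} {g : Y ⟶ Z} {f' : X ⟶ Y'}
    {g' : Y' ⟶ Z} (h : f ≫ g = f' ≫ g') (A : p.Fiber Z) :
    (reindexObj p f (reindexObj p g A)).1 ⟶ (reindexObj p g' A).1 :=
  Functor.IsStronglyCartesian.map p g' (cartLift p g' A) h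
    (cartLift p f (reindexObj p g A) ≫ cartLift p g A)

instance reindexCommAux_isHomLift {X Y Y' Z : B} {f : X ⟶ Y} {g : Y ⟶ Z} {f' : X ⟶ Y'}
    {g' : Y' ⟶ Z} (h : f ≫ g = f' ≫ g') (A : p.Fiber Z) :
    p.IsHomLift f' (reindexCommAux p h A) :=
  Functor.IsStronglyCartesian.map_isHomLift p g' (cartLift p g' A) h
    (cartLift p f (reindexObj p g A) ≫ cartLift p g A)

/-- The canonical comparison `f^* g^* A ⟶ f'^* g'^* A` attached to a commutative square
`f ≫ g = f' ≫ g'` in the base: the unique vertical arrow compatible with the cartesian lifts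
into `A`. -/
noncomputable def reindexComm {X Y Y' Z : B} {f : X ⟶ Y} {g : Y ⟶ Z} {f' : X ⟶ Y'} {g' : Y' ⟶ Z}
    (h : f ≫ g = f' ≫ g') (A : p.Fiber Z) :
    (reindex p f).obj ((reindex p g).obj A) ⟶ (reindex p f').obj ((reindex p g').obj A) :=
  vertLift p f' (C := reindexObj p f (reindexObj p g A)) (A := reindexObj p g' A)
    (reindexCommAux p h A) (reindexCommAux_isHomLift p h A)

end Reindexing

section Elementary

universe v₁ v₂ u₁ u₂

variable {B : Type u₁} {E : Type u₂} [Category.{v₁} B] [Category.{v₂} E]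

/-- A fibration with finite products: a fibration whose base and fibres have finite products, the
latter being preserved by reindexing. -/
class IsFibrationWithProducts (p : E ⥤ B) : Prop where
  isFibered : p.IsFibered
  base : HasFiniteProducts B
  fiber : ∀ X : B, HasFiniteProducts (p.Fiber X)
  reindex_preserves : ∀ {X Y : B} (f : X ⟶ Y), PreservesFiniteProducts (reindex p f)

attribute [instance] IsFibrationWithProducts.isFibered IsFibrationWithProducts.fiber

section ParamDiag

variable [HasFiniteProducts B]

/-- The parametrised diagonal `⟨pr₁, pr₂, pr₂⟩ : Y × X ⟶ Y × X × X`. -/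
noncomputable def paramDiag (Y X : B) : Y ⨯ X ⟶ (Y ⨯ X) ⨯ X :=
  prod.lift (𝟙 (Y ⨯ X)) prod.snd

/-- The square with sides `f × X`, `f × X × X` and the parametrised diagonals commutes. -/
theorem paramDiag_square {Y Z : B} (f : Y ⟶ Z) (X : B) :
    prod.map f (𝟙 X) ≫ paramDiag Z X = paramDiag Y X ≫ prod.map (prod.map f (𝟙 X)) (𝟙 X) := by
  ext <;> simp [paramDiag]

end ParamDiag

variable (p : E ⥤ B)

/-- The canonical arrow `Σ (d^* B ∧ A) ⟶ B ∧ Σ A` of Frobenius Reciprocity, for a left adjoint `Σ`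
to reindexing along `d`. -/
noncomputable def frobeniusMap [IsFibrationWithProducts p] {X Y : B} {d : X ⟶ Y}
    {S : p.Fiber X ⥤ p.Fiber Y} (adj : S ⊣ reindex p d) (A : p.Fiber X) (C : p.Fiber Y) :
    S.obj ((reindex p d).obj C ⨯ A) ⟶ C ⨯ S.obj A :=
  prod.lift (S.map prod.fst ≫ adj.counit.app C) (S.map prod.snd)

/-- The canonical arrow `Σ f^* A ⟶ g^* Σ' A` of the Beck-Chevalley Condition, for a commutative
square `f ≫ d' = d ≫ g` and left adjoints `Σ` and `Σ'` to reindexing along `d` and `d'`. It is the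
transpose of `f^* A ⟶ f^* d'^* Σ' A ≅ d^* g^* Σ' A`, the first arrow being `f^*` of the unit. -/
noncomputable def beckChevalleyMap [p.IsFibered] {X X' Y Y' : B} {d : X ⟶ Y} {d' : X' ⟶ Y'}
    {f : X ⟶ X'} {g : Y ⟶ Y'} (sq : f ≫ d' = d ≫ g)
    {S : p.Fiber X ⥤ p.Fiber Y} (adj : S ⊣ reindex p d)
    {S' : p.Fiber X' ⥤ p.Fiber Y'} (adj' : S' ⊣ reindex p d') (A : p.Fiber X') :
    S.obj ((reindex p f).obj A) ⟶ (reindex p g).obj (S'.obj A) :=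
  (adj.homEquiv _ _).symm
    ((reindex p f).map (adj'.unit.app A) ≫ reindexComm p sq (S'.obj A))

/-- An elementary fibration: a fibration with finite products such that reindexing along every
parametrised diagonal `Y × X ⟶ Y × X × X` has a left adjoint, and these left adjoints satisfy
Frobenius Reciprocity and the Beck-Chevalley Condition. -/
structure IsElementary (p : E ⥤ B) : Prop extends IsFibrationWithProducts p where
  exists_leftAdjoints :
    ∃ (S : ∀ Y X : B, p.Fiber (Y ⨯ X) ⥤ p.Fiber ((Y ⨯ X) ⨯ X))
      (adj : ∀ Y X : B, S Y X ⊣ reindex p (paramDiag Y X)),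
      (∀ (Y X : B) (A : p.Fiber (Y ⨯ X)) (C : p.Fiber ((Y ⨯ X) ⨯ X)),
        IsIso (frobeniusMap p (adj Y X) A C)) ∧
      (∀ {Y Z : B} (f : Y ⟶ Z) (X : B) (A : p.Fiber (Z ⨯ X)),
        IsIso (beckChevalleyMap p (paramDiag_square f X) (adj Y X) (adj Z X) A))

end Elementary

section AWFS

universe v

/-- A functorial factorisation `f = L f ≫ R f` through `M f`. -/
structure FunctorialFactorisation (C : Type u) [Category.{v} C] where
  M : Arrow C ⥤ C
  lam : Arrow.leftFunc ⟶ M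
  rho : M ⟶ Arrow.rightFunc
  fac : ∀ f : Arrow C, lam.app f ≫ rho.app f = f.hom

namespace FunctorialFactorisation

variable {C : Type u} [Category.{v} C] (Φ : FunctorialFactorisation C)

/-- The left functor `L` of the factorisation. -/
@[simps]
def L : Arrow C ⥤ Arrow C where
  obj f := Arrow.mk (Φ.lam.app f)
  map {f g} s := Arrow.homMk s.left (Φ.M.map s) (Φ.lam.naturality s)

/-- The right functor `R` of the factorisation. -/
@[simps]
def R : Arrow C ⥤ Arrow C where
  obj f := Arrow.mk (Φ.rho.app f)
  map {f g} s := Arrow.homMk (Φ.M.map s) s.right (Φ.rho.naturality s)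

/-- The counit `L f ⟶ f`, given by `(id, R f)`. -/
def counit (f : Arrow C) : Φ.L.obj f ⟶ f :=
  Arrow.homMk (𝟙 _) (Φ.rho.app f) ((Category.id_comp _).trans (Φ.fac f).symm)

/-- The unit `f ⟶ R f`, given by `(L f, id)`. -/
def unit (f : Arrow C) : f ⟶ Φ.R.obj f :=
  Arrow.homMk (Φ.lam.app f) (𝟙 _) ((Φ.fac f).trans (Category.comp_id _).symm)

end FunctorialFactorisation

/-- An algebraic weak factorisation system: a functorial factorisation with a comultiplication
`(id, Δ) : L ⟶ L L` making `L` (with its counit) a comonad, a multiplication `(μ, id) : R R ⟶ R`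
making `R` (with its unit) a monad, such that `(Δ, μ) : L R ⟶ R L` is a distributive law. -/
structure AWFS (C : Type u) [Category.{v} C] extends FunctorialFactorisation C where
  comul : ∀ f : Arrow C, M.obj f ⟶ M.obj (toFunctorialFactorisation.L.obj f)
  comul_natural : ∀ {f g : Arrow C} (s : f ⟶ g),
    M.map s ≫ comul g = comul f ≫ M.map (toFunctorialFactorisation.L.map s)
  lam_comul : ∀ f, lam.app f ≫ comul f = lam.app (toFunctorialFactorisation.L.obj f)
  comul_rho : ∀ f, comul f ≫ rho.app (toFunctorialFactorisation.L.obj f) = 𝟙 (M.obj f)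
  comul_counit : ∀ f, comul f ≫ M.map (toFunctorialFactorisation.counit f) = 𝟙 (M.obj f)
  coassoc : ∀ f, comul f ≫ comul (toFunctorialFactorisation.L.obj f) =
    comul f ≫ M.map (X := toFunctorialFactorisation.L.obj f)
      (Y := toFunctorialFactorisation.L.obj (toFunctorialFactorisation.L.obj f))
      (Arrow.homMk (𝟙 _) (comul f) ((Category.id_comp _).trans (lam_comul f).symm))
  mul : ∀ f : Arrow C, M.obj (toFunctorialFactorisation.R.obj f) ⟶ M.obj f
  mul_natural : ∀ {f g : Arrow C} (s : f ⟶ g),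
    M.map (toFunctorialFactorisation.R.map s) ≫ mul g = mul f ≫ M.map s
  mul_rho : ∀ f, mul f ≫ rho.app f = rho.app (toFunctorialFactorisation.R.obj f)
  lam_mul : ∀ f, lam.app (toFunctorialFactorisation.R.obj f) ≫ mul f = 𝟙 (M.obj f)
  unit_mul : ∀ f, M.map (toFunctorialFactorisation.unit f) ≫ mul f = 𝟙 (M.obj f)
  assoc : ∀ f, mul (toFunctorialFactorisation.R.obj f) ≫ mul f =
    M.map (X := toFunctorialFactorisation.R.obj (toFunctorialFactorisation.R.obj f))
      (Y := toFunctorialFactorisation.R.obj f)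
      (Arrow.homMk (mul f) (𝟙 _) ((mul_rho f).trans (Category.comp_id _).symm)) ≫ mul f
  distrib : ∀ f, mul f ≫ comul f =
    comul (toFunctorialFactorisation.R.obj f) ≫
      M.map (X := toFunctorialFactorisation.L.obj (toFunctorialFactorisation.R.obj f))
        (Y := toFunctorialFactorisation.R.obj (toFunctorialFactorisation.L.obj f))
        (Arrow.homMk (comul f) (mul f) ((comul_rho f).trans (lam_mul f).symm)) ≫
      mul (toFunctorialFactorisation.L.obj f)

namespace AWFS

variable {C : Type u} [Category.{v} C] (W : AWFS C)

/-- The comonad with underlying functor `L`. -/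
def comonadL : Comonad (Arrow C) where
  toFunctor := W.L
  ε := { app f := W.counit f
         naturality f g s := by
           ext
           · exact (Category.comp_id _).trans (Category.id_comp _).symm
           · exact W.rho.naturality s }
  δ := { app f := Arrow.homMk (𝟙 _) (W.comul f)
           ((Category.id_comp _).trans (W.lam_comul f).symm)
         naturality f g s := by
           ext
           · exact (Category.comp_id _).trans (Category.id_comp _).symm
           · exact W.comul_natural s }
  coassoc f := by
    ext
    · rfl
    · exact (W.coassoc f).symm
  left_counit f := by
    ext
    · exact Category.comp_id _
    · exact W.comul_rho f
  right_counit f := by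
    ext
    · exact Category.comp_id _
    · exact W.comul_counit f

/-- The monad with underlying functor `R`. -/
def monadR : Monad (Arrow C) where
  toFunctor := W.R
  η := { app f := W.unit f
         naturality f g s := by
           ext
           · exact W.lam.naturality s
           · exact (Category.comp_id _).trans (Category.id_comp _).symm }
  μ := { app f := Arrow.homMk (W.mul f) (𝟙 _)
           ((W.mul_rho f).trans (Category.comp_id _).symm)
         naturality f g s := by
           ext
           · exact W.mul_natural s
           · exact (Category.comp_id _).trans (Category.id_comp _).symm }
  assoc f := by
    ext
    · exact (W.assoc f).symm
    · rfl
  left_unit f := by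
    ext
    · exact W.lam_mul f
    · exact Category.comp_id _
  right_unit f := by
    ext
    · exact W.unit_mul f
    · exact Category.comp_id _

/-- The category `R-Alg` of algebras for the monad `R`. -/
abbrev RAlg := W.monadR.Algebra

/-- The forgetful functor `R-Alg ⥤ C`, sending an algebra on an arrow to the codomain of that
arrow. -/
def algFunctor : W.RAlg ⥤ C := W.monadR.forget ⋙ Arrow.rightFunc

end AWFS

end AWFS

section PathObject

variable {X A B A' B' : Type u} [Category.{u} X] [Groupoid.{u} A] [Groupoid.{u} B]
  [Groupoid.{u} A'] [Groupoid.{u} B']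

/-- The objects `(A, x : B ≅ F A)` of `M F`, for a functor `F` between groupoids. As every arrow of a
groupoid is invertible, `x` is just an arrow. -/
structure PathObj (F : A ⥤ B) where
  base : B
  pt : A
  iso : base ⟶ F.obj pt

namespace PathObj

/-- The arrows `(b, a)` of `M F`: commutative squares. -/
@[ext]
structure Hom {F : A ⥤ B} (P Q : PathObj F) where
  base : P.base ⟶ Q.base
  pt : P.pt ⟶ Q.pt
  w : base ≫ Q.iso = P.iso ≫ F.map pt

instance (F : A ⥤ B) : Groupoid (PathObj F) where
  Hom P Q := Hom P Q
  id P := ⟨𝟙 _, 𝟙 _, by simp⟩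
  comp f g := ⟨f.base ≫ g.base, f.pt ≫ g.pt, by
    rw [Category.assoc, g.w, ← Category.assoc, f.w, Category.assoc, F.map_comp]⟩
  inv f := ⟨Groupoid.inv f.base, Groupoid.inv f.pt, by
    rw [Groupoid.inv_eq_inv, Groupoid.inv_eq_inv, IsIso.inv_comp_eq, F.map_inv,
      ← Category.assoc, f.w, Category.assoc, IsIso.hom_inv_id, Category.comp_id]⟩
  id_comp f := Hom.ext (Category.id_comp _) (Category.id_comp _)
  comp_id f := Hom.ext (Category.comp_id _) (Category.comp_id _)
  assoc f g h := Hom.ext (Category.assoc _ _ _) (Category.assoc _ _ _)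
  inv_comp f := Hom.ext (Groupoid.inv_comp _) (Groupoid.inv_comp _)
  comp_inv f := Hom.ext (Groupoid.comp_inv _) (Groupoid.comp_inv _)

variable {F : A ⥤ B}

@[ext]
theorem hom_ext {P Q : PathObj F} {f g : P ⟶ Q} (h : f.base = g.base) (h' : f.pt = g.pt) :
    f = g :=
  Hom.ext h h'

@[simp] theorem id_base (P : PathObj F) : Hom.base (𝟙 P) = 𝟙 P.base := rfl
@[simp] theorem id_pt (P : PathObj F) : Hom.pt (𝟙 P) = 𝟙 P.pt := rfl
@[simp] theorem comp_base {P Q S : PathObj F} (f : P ⟶ Q) (g : Q ⟶ S) :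
    (f ≫ g).base = f.base ≫ g.base := rfl
@[simp] theorem comp_pt {P Q S : PathObj F} (f : P ⟶ Q) (g : Q ⟶ S) :
    (f ≫ g).pt = f.pt ≫ g.pt := rfl

theorem eqToHom_base {P Q : PathObj F} (h : P = Q) :
    (eqToHom h).base = eqToHom (congrArg base h) := by
  subst h; rfl

theorem eqToHom_pt {P Q : PathObj F} (h : P = Q) :
    (eqToHom h).pt = eqToHom (congrArg pt h) := by
  subst h; rfl

/-- The functor `R F : M F ⥤ B`. -/
abbrev baseFunctor (F : A ⥤ B) : PathObj F ⥤ B where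
  obj P := P.base
  map f := f.base

/-- The functor `M F ⥤ A`, `(A, x) ↦ A`. -/
abbrev ptFunctor (F : A ⥤ B) : PathObj F ⥤ A where
  obj P := P.pt
  map f := f.pt

/-- A functor into `M F` is given by functors `b` into `B` and `a` into `A` and a natural
isomorphism `b ≅ F a`. -/
@[simps]
def lift (b : X ⥤ B) (a : X ⥤ A) (α : ∀ x, b.obj x ⟶ F.obj (a.obj x))
    (hα : ∀ {x y : X} (f : x ⟶ y), b.map f ≫ α y = α x ≫ F.map (a.map f)) : X ⥤ PathObj F where
  obj x := ⟨b.obj x, a.obj x, α x⟩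
  map f := ⟨b.map f, a.map f, hα f⟩
  map_id x := hom_ext (b.map_id x) (a.map_id x)
  map_comp f g := hom_ext (b.map_comp f g) (a.map_comp f g)

theorem lift_ext {b b' : X ⥤ B} {a a' : X ⥤ A} {α : ∀ x, b.obj x ⟶ F.obj (a.obj x)}
    {β : ∀ x, b'.obj x ⟶ F.obj (a'.obj x)}
    {hα : ∀ {x y : X} (f : x ⟶ y), b.map f ≫ α y = α x ≫ F.map (a.map f)}
    {hβ : ∀ {x y : X} (f : x ⟶ y), b'.map f ≫ β y = β x ≫ F.map (a'.map f)}
    (hb : b = b') (ha : a = a') (h : ∀ x, α x ≫ F.map (eqToHom (Functor.congr_obj ha x)) =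
      eqToHom (Functor.congr_obj hb x) ≫ β x) :
    lift b a α hα = lift b' a' β hβ := by
  subst hb
  subst ha
  have : α = β := funext fun x => by simpa using h x
  subst this
  rfl

/-- Two functors into `M F` with the same components agree if their isomorphisms agree. -/
theorem functor_ext {G H : X ⥤ PathObj F} (hb : G ⋙ baseFunctor F = H ⋙ baseFunctor F)
    (hp : G ⋙ ptFunctor F = H ⋙ ptFunctor F)
    (h : ∀ x, (G.obj x).iso ≫ F.map (eqToHom (Functor.congr_obj hp x)) =
      eqToHom (Functor.congr_obj hb x) ≫ (H.obj x).iso) : G = H :=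
  lift_ext (b := G ⋙ baseFunctor F) (b' := H ⋙ baseFunctor F) (a := G ⋙ ptFunctor F)
    (a' := H ⋙ ptFunctor F) (α := fun x => (G.obj x).iso) (β := fun x => (H.obj x).iso)
    (hα := fun f => (G.map f).w) (hβ := fun f => (H.map f).w) hb hp h

/-- The functor `L F : A ⥤ M F`, `A ↦ (A, id)`. -/
abbrev lam (F : A ⥤ B) : A ⥤ PathObj F :=
  lift F (𝟭 A) (fun a => 𝟙 (F.obj a))
    (fun f => (Category.comp_id (F.map f)).trans (Category.id_comp (F.map f)).symm)

theorem sq_obj {F : A ⥤ B} {G : A' ⥤ B'} {H : A ⥤ A'} {K : B ⥤ B'} (h : H ⋙ G = F ⋙ K) (a : A) :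
    K.obj (F.obj a) = G.obj (H.obj a) :=
  (Functor.congr_obj h a).symm

theorem map_naturality {F : A ⥤ B} {G : A' ⥤ B'} {H : A ⥤ A'} {K : B ⥤ B'} (h : H ⋙ G = F ⋙ K)
    {P Q : PathObj F} (f : P ⟶ Q) :
    K.map f.base ≫ K.map Q.iso ≫ eqToHom (sq_obj h Q.pt) =
      (K.map P.iso ≫ eqToHom (sq_obj h P.pt)) ≫ G.map (H.map f.pt) := by
  have e := Functor.congr_hom h f.pt
  simp only [Functor.comp_map] at e
  rw [e, ← Category.assoc, ← K.map_comp, f.w]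
  simp

/-- The action of `M` on a commutative square `(H, K)` from `F` to `G`:
`(A, x) ↦ (H A, K x)`. -/
abbrev map {F : A ⥤ B}
    {G : A' ⥤ B'} {H : A ⥤ A'} {K : B ⥤ B'} (h : H ⋙ G = F ⋙ K) : PathObj F ⥤ PathObj G :=
  lift (baseFunctor F ⋙ K) (ptFunctor F ⋙ H)
    (fun P => K.map P.iso ≫ eqToHom (sq_obj h P.pt)) (map_naturality h)

/-- The comultiplication `(A, x) ↦ (A, (x, id) : (A, x) ≅ (L F) A)`. -/
abbrev comul (F : A ⥤ B) : PathObj F ⥤ PathObj (lam F) :=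
  lift (F := lam F) (𝟭 (PathObj F)) (ptFunctor F)
    (fun P => ⟨P.iso, 𝟙 P.pt, congrArg (fun t => P.iso ≫ t) (F.map_id P.pt).symm⟩)
    (fun f => hom_ext f.w ((Category.comp_id f.pt).trans (Category.id_comp f.pt).symm))

theorem mul_naturality {F : A ⥤ B} {P Q : PathObj (baseFunctor F)} (f : P ⟶ Q) :
    f.base ≫ Q.iso ≫ Q.pt.iso = (P.iso ≫ P.pt.iso) ≫ F.map f.pt.pt := by
  have e : f.base ≫ Q.iso = P.iso ≫ f.pt.base := f.w
  have e' : f.pt.base ≫ Q.pt.iso = P.pt.iso ≫ F.map f.pt.pt := f.pt.w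
  rw [Category.assoc, ← e', ← Category.assoc, e, Category.assoc]

/-- The multiplication `((A, x : B ≅ F A), x' : B' ≅ B) ↦ (A, x x' : B' ≅ F A)`. -/
abbrev mul (F : A ⥤ B) : PathObj (baseFunctor F) ⥤ PathObj F :=
  lift (baseFunctor (baseFunctor F)) (ptFunctor (baseFunctor F) ⋙ ptFunctor F)
    (fun P => P.iso ≫ P.pt.iso) mul_naturality

end PathObj

section Laws

open PathObj

variable {A'' B'' : Type u} [Groupoid.{u} A''] [Groupoid.{u} B'']
  {F : A ⥤ B} {F' : A' ⥤ B'} {F'' : A'' ⥤ B''}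

theorem map_id' (h : 𝟭 A ⋙ F = F ⋙ 𝟭 B) : PathObj.map h = 𝟭 (PathObj F) := by
  refine functor_ext rfl rfl fun P => ?_
  change (P.iso ≫ 𝟙 (F.obj P.pt)) ≫ F.map (𝟙 P.pt) = 𝟙 P.base ≫ P.iso
  simp

theorem map_comp' {H : A ⥤ A'} {K : B ⥤ B'} {H' : A' ⥤ A''} {K' : B' ⥤ B''}
    (h : H ⋙ F' = F ⋙ K) (h' : H' ⋙ F'' = F' ⋙ K') (h'' : (H ⋙ H') ⋙ F'' = F ⋙ (K ⋙ K')) :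
    PathObj.map h'' = PathObj.map h ⋙ PathObj.map h' := by
  refine functor_ext rfl rfl fun P => ?_
  change (K'.map (K.map P.iso) ≫ eqToHom (sq_obj h'' P.pt)) ≫ F''.map (𝟙 (H'.obj (H.obj P.pt))) =
    𝟙 (K'.obj (K.obj P.base)) ≫ K'.map (K.map P.iso ≫ eqToHom (sq_obj h P.pt)) ≫
      eqToHom (sq_obj h' (H.obj P.pt))
  simp [eqToHom_map]

theorem lam_nat {H : A ⥤ A'} {K : B ⥤ B'} (h : H ⋙ F' = F ⋙ K) :
    H ⋙ lam F' = lam F ⋙ PathObj.map h := by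
  refine functor_ext h rfl fun a => ?_
  change 𝟙 (F'.obj (H.obj a)) ≫ F'.map (𝟙 (H.obj a)) = eqToHom (sq_obj h a).symm ≫
    K.map (𝟙 (F.obj a)) ≫ eqToHom (sq_obj h a)
  simp

theorem comul_nat {H : A ⥤ A'} {K : B ⥤ B'} (h : H ⋙ F' = F ⋙ K) :
    PathObj.map h ⋙ comul F' = comul F ⋙ PathObj.map (lam_nat h) := by
  refine functor_ext rfl rfl fun P => hom_ext ?_ ?_
  · change (K.map P.iso ≫ eqToHom (sq_obj h P.pt)) ≫ F'.map (𝟙 (H.obj P.pt)) =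
      𝟙 (K.obj P.base) ≫ K.map P.iso ≫ (eqToHom (sq_obj (lam_nat h) P.pt)).base
    rw [eqToHom_base]
    simp
    rfl
  · change 𝟙 (H.obj P.pt) ≫ 𝟙 (H.obj P.pt) =
      𝟙 (H.obj P.pt) ≫ H.map (𝟙 P.pt) ≫ (eqToHom (sq_obj (lam_nat h) P.pt)).pt
    rw [eqToHom_pt]
    simp
    exact (Category.id_comp _).symm

theorem lam_comul' : lam F ⋙ comul F = lam (lam F) := by
  refine functor_ext rfl rfl fun P => hom_ext ?_ ?_
  · change 𝟙 (F.obj P) ≫ F.map (𝟙 P) = 𝟙 (F.obj P) ≫ 𝟙 (F.obj P)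
    simp
  · rfl

theorem comul_counit' (h : 𝟭 A ⋙ F = lam F ⋙ baseFunctor F) :
    comul F ⋙ PathObj.map h = 𝟭 (PathObj F) := by
  refine functor_ext rfl rfl fun P => ?_
  change (P.iso ≫ 𝟙 (F.obj P.pt)) ≫ F.map (𝟙 P.pt) = 𝟙 P.base ≫ P.iso
  simp

theorem coassoc' (h : 𝟭 A ⋙ lam (lam F) = lam F ⋙ comul F) :
    comul F ⋙ comul (lam F) = comul F ⋙ PathObj.map h := by
  refine functor_ext rfl rfl fun P => hom_ext (hom_ext ?_ ?_) ?_
  · change P.iso ≫ F.map (𝟙 P.pt) =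
      𝟙 P.base ≫ P.iso ≫ 𝟙 (F.obj P.pt)
    simp
  · change 𝟙 P.pt ≫ 𝟙 P.pt = 𝟙 P.pt ≫ 𝟙 P.pt ≫ 𝟙 P.pt
    simp
  · change 𝟙 P.pt ≫ 𝟙 P.pt = 𝟙 P.pt ≫ 𝟙 P.pt ≫ 𝟙 P.pt
    simp

theorem mul_nat {H : A ⥤ A'} {K : B ⥤ B'} (h : H ⋙ F' = F ⋙ K)
    (h' : PathObj.map h ⋙ baseFunctor F' = baseFunctor F ⋙ K) :
    PathObj.map h' ⋙ mul F' = mul F ⋙ PathObj.map h := by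
  refine functor_ext rfl rfl fun P => ?_
  change ((K.map P.iso ≫ 𝟙 (K.obj P.pt.base)) ≫ K.map P.pt.iso ≫ eqToHom (sq_obj h P.pt.pt)) ≫
      F'.map (𝟙 (H.obj P.pt.pt)) =
    𝟙 (K.obj P.base) ≫ K.map (P.iso ≫ P.pt.iso) ≫ eqToHom (sq_obj h P.pt.pt)
  have e : K.map (P.iso ≫ P.pt.iso) = K.map P.iso ≫ K.map P.pt.iso := K.map_comp _ _
  rw [e]
  simp

theorem lam_mul' : lam (baseFunctor F) ⋙ mul F = 𝟭 (PathObj F) := by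
  refine functor_ext rfl rfl fun P => ?_
  change (𝟙 P.base ≫ P.iso) ≫ F.map (𝟙 P.pt) = 𝟙 P.base ≫ P.iso
  simp

theorem unit_mul' (h : lam F ⋙ baseFunctor F = F ⋙ 𝟭 B) :
    PathObj.map h ⋙ mul F = 𝟭 (PathObj F) := by
  refine functor_ext rfl rfl fun P => ?_
  change ((P.iso ≫ 𝟙 (F.obj P.pt)) ≫ 𝟙 (F.obj P.pt)) ≫ F.map (𝟙 P.pt) = 𝟙 P.base ≫ P.iso
  simp

theorem assoc' (h : mul F ⋙ baseFunctor F = baseFunctor (baseFunctor F) ⋙ 𝟭 B) :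
    mul (baseFunctor F) ⋙ mul F = PathObj.map h ⋙ mul F := by
  refine functor_ext rfl rfl fun P => ?_
  have key : ∀ {b₁ b₂ b₃ : B} (x : b₁ ⟶ b₂) (y : b₂ ⟶ b₃) (z : b₃ ⟶ F.obj P.pt.pt.pt),
      ((x ≫ y) ≫ z) ≫ F.map (𝟙 P.pt.pt.pt) = 𝟙 b₁ ≫ (x ≫ 𝟙 b₂) ≫ y ≫ z := by
    intros; simp
  exact key P.iso P.pt.iso P.pt.pt.iso

theorem distrib' (h : comul F ⋙ baseFunctor (lam F) = lam (baseFunctor F) ⋙ mul F) :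
    mul F ⋙ comul F = comul (baseFunctor F) ⋙ PathObj.map h ⋙ mul (lam F) := by
  refine functor_ext rfl rfl fun P => hom_ext ?_ ?_
  · have e : (eqToHom (sq_obj h P.pt)).base = 𝟙 P.pt.base := eqToHom_base _
    change (P.iso ≫ P.pt.iso) ≫ F.map (𝟙 P.pt.pt) =
      𝟙 P.base ≫ (P.iso ≫ (eqToHom (sq_obj h P.pt)).base) ≫ P.pt.iso
    rw [e]
    have key : ∀ {b₁ b₂ : B} (x : b₁ ⟶ b₂) (y : b₂ ⟶ F.obj P.pt.pt),
        (x ≫ y) ≫ F.map (𝟙 P.pt.pt) = 𝟙 b₁ ≫ (x ≫ 𝟙 b₂) ≫ y := by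
      intros; simp
    exact key P.iso P.pt.iso
  · have e : (eqToHom (sq_obj h P.pt)).pt = 𝟙 P.pt.pt := eqToHom_pt _
    change 𝟙 P.pt.pt ≫ 𝟙 P.pt.pt =
      𝟙 P.pt.pt ≫ (𝟙 P.pt.pt ≫ (eqToHom (sq_obj h P.pt)).pt) ≫ 𝟙 P.pt.pt
    rw [e]
    have key : ∀ a : A, 𝟙 a ≫ 𝟙 a = 𝟙 a ≫ (𝟙 a ≫ 𝟙 a) ≫ 𝟙 a := by
      intros; simp
    exact key P.pt.pt

end Laws

/-- The functorial factorisation `A ⥤ M F ⥤ B` on groupoids. -/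
def grpdFactorisation : FunctorialFactorisation Grpd.{u, u} where
  M :=
    { obj f := Grpd.of (PathObj (A := f.left) (B := f.right) f.hom)
      map {f g} s := PathObj.map (A := f.left) (B := f.right) (A' := g.left) (B' := g.right)
        (F := f.hom) (G := g.hom) (H := s.left) (K := s.right) s.w
      map_id f := map_id' (A := f.left) (B := f.right) (F := f.hom) rfl
      map_comp {f g k} s t := map_comp' (A := f.left) (B := f.right) (A' := g.left)
        (B' := g.right) (A'' := k.left) (B'' := k.right) (F := f.hom) (F' := g.hom) (F'' := k.hom)
        (H := s.left) (K := s.right) (H' := t.left) (K' := t.right) s.w t.w (s ≫ t).w }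
  lam :=
    { app f := PathObj.lam (A := f.left) (B := f.right) f.hom
      naturality f g s := lam_nat (A := f.left) (B := f.right) (A' := g.left) (B' := g.right)
        (F := f.hom) (F' := g.hom) (H := s.left) (K := s.right) s.w }
  rho :=
    { app f := PathObj.baseFunctor (A := f.left) (B := f.right) f.hom
      naturality _ _ _ := rfl }
  fac _ := rfl

/-- The algebraic weak factorisation system on the category of (small) groupoids. -/
def grpdAWFS : AWFS Grpd.{u, u} where
  toFunctorialFactorisation := grpdFactorisation
  comul f := PathObj.comul (A := f.left) (B := f.right) f.hom
  comul_natural {f g} s := comul_nat (A := f.left) (B := f.right) (A' := g.left) (B' := g.right)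
    (F := f.hom) (F' := g.hom) (H := s.left) (K := s.right) s.w
  lam_comul f := lam_comul' (A := f.left) (B := f.right) (F := f.hom)
  comul_rho _ := rfl
  comul_counit f := comul_counit' (A := f.left) (B := f.right) (F := f.hom) rfl
  coassoc f := coassoc' (A := f.left) (B := f.right) (F := f.hom)
    (lam_comul' (A := f.left) (B := f.right) (F := f.hom)).symm
  mul f := PathObj.mul (A := f.left) (B := f.right) f.hom
  mul_natural {f g} s := mul_nat (A := f.left) (B := f.right) (A' := g.left) (B' := g.right)
    (F := f.hom) (F' := g.hom) (H := s.left) (K := s.right) s.w rfl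
  mul_rho _ := rfl
  lam_mul f := lam_mul' (A := f.left) (B := f.right) (F := f.hom)
  unit_mul f := unit_mul' (A := f.left) (B := f.right) (F := f.hom) rfl
  assoc f := assoc' (A := f.left) (B := f.right) (F := f.hom) rfl
  distrib f := distrib' (A := f.left) (B := f.right) (F := f.hom)
    ((lam_mul' (A := f.left) (B := f.right) (F := f.hom)).symm)

end PathObject

section SplitIsofibration

/-- A split cleavage for a functor `F` between groupoids: a choice, for every object `a` and every
isomorphism `x : b ⟶ F a`, of an isomorphism `lift a x` into `a` over `x`, such that the chosen lifts
of identities are identities and the chosen lifts of composites are the composites of the chosen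
lifts. -/
structure SplitCleavage {A B : Type u} [Groupoid.{u} A] [Groupoid.{u} B] (F : A ⥤ B) where
  lift : ∀ (a : A) {b : B} (_ : b ⟶ F.obj a), Over a
  obj_lift : ∀ (a : A) {b : B} (x : b ⟶ F.obj a), F.obj (lift a x).left = b
  map_lift : ∀ (a : A) {b : B} (x : b ⟶ F.obj a),
    F.map (lift a x).hom = eqToHom (obj_lift a x) ≫ x
  lift_id : ∀ a : A, lift a (𝟙 (F.obj a)) = Over.mk (𝟙 a)
  lift_comp : ∀ (a : A) {b c : B} (y : c ⟶ b) (x : b ⟶ F.obj a),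
    lift a (y ≫ x) = (Over.map (lift a x).hom).obj
      (lift (lift a x).left (y ≫ eqToHom (obj_lift a x).symm))

/-- A split cloven isofibration of groupoids. -/
structure SplitIsofib where
  arrow : Arrow Grpd.{u, u}
  cleavage : SplitCleavage (A := arrow.left) (B := arrow.right) arrow.hom

namespace SplitIsofib

/-- A commutative square between split cloven isofibrations preserves the cleavages strictly. -/
def Preserves (P Q : SplitIsofib.{u}) (s : P.arrow ⟶ Q.arrow) : Prop :=
  ∀ (a : P.arrow.left) {b : P.arrow.right} (x : b ⟶ P.arrow.hom.obj a),
    (Over.post s.left).obj (P.cleavage.lift a x) =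
      Q.cleavage.lift (s.left.obj a) (s.right.map x ≫ eqToHom (PathObj.sq_obj s.w a))

theorem preserves_id (P : SplitIsofib.{u}) : Preserves P P (𝟙 P.arrow) := by
  intro a b x
  have e : x ≫ 𝟙 _ = x := Category.comp_id x
  change P.cleavage.lift a x = P.cleavage.lift a (x ≫ 𝟙 _)
  rw [e]

theorem preserves_comp {P Q S : SplitIsofib.{u}} {s : P.arrow ⟶ Q.arrow} {t : Q.arrow ⟶ S.arrow}
    (hs : Preserves P Q s) (ht : Preserves Q S t) : Preserves P S (s ≫ t) := by
  intro a b x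
  have h₁ := congrArg (Over.post t.left).obj (hs a x)
  have h₂ := ht (s.left.obj a) (s.right.map x ≫ eqToHom (PathObj.sq_obj s.w a))
  refine h₁.trans (h₂.trans ?_)
  have e : t.right.map (s.right.map x ≫ eqToHom (PathObj.sq_obj s.w a)) ≫
      eqToHom (PathObj.sq_obj t.w (s.left.obj a)) =
      (s ≫ t).right.map x ≫ eqToHom (PathObj.sq_obj (s ≫ t).w a) := by
    rw [Functor.map_comp, eqToHom_map]
    exact (Category.assoc _ _ _).trans (congrArg _ (eqToHom_trans _ _))
  exact congrArg (fun y => S.cleavage.lift (t.left.obj (s.left.obj a)) y) e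

/-- The category of split cloven isofibrations of groupoids, with arrows the commutative squares
preserving the cleavages strictly. -/
instance : Category SplitIsofib.{u} where
  Hom P Q := { s : P.arrow ⟶ Q.arrow // Preserves P Q s }
  id P := ⟨𝟙 P.arrow, preserves_id P⟩
  comp s t := ⟨s.1 ≫ t.1, preserves_comp s.2 t.2⟩
  id_comp s := Subtype.ext (Category.id_comp s.1)
  comp_id s := Subtype.ext (Category.comp_id s.1)
  assoc s t r := Subtype.ext (Category.assoc s.1 t.1 r.1)

/-- The functor forgetting the cleavage. -/
def forget : SplitIsofib.{u} ⥤ Arrow Grpd.{u, u} where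
  obj P := P.arrow
  map s := s.1

end SplitIsofib

end SplitIsofibration

end ElemFib

/-
An algebra `c` over `J` is an operation transporting generalised elements of `c` backwards along
generalised arrows of `J`: an element over the codomain of a path is sent to one over its domain.
Any arrow of algebras over `J` can in this way be transported along a path in `J`.

The left adjoint to reindexing along `δ = ⟨pr₁, pr₂, pr₂⟩` sends an algebra `a` over `Y × X` to
the algebra of pairs of an element of `a` over `(y, x)` and an arrow `x' ⟶ x`. The arrow `η` from
`a` which sends an element to its pair with an identity is cocartesian over `δ`, because the arrow
`x' ⟶ x` is a path from each pair to its image under the retraction of `η`. Such a deformation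
retraction survives the product with a cartesian arrow over `δ` and pullback along `f × X × X`,
which gives Frobenius reciprocity and the Beck–Chevalley condition.

An action `s` of the monad on `F` amounts to the natural arrows `s (a, x) ⟶ a`, obtained by applying
`s` to the canonical arrow `(a, x) ⟶ (a, 𝟙)`; these are the chosen lifts of a split cleavage.
-/

namespace ElemFib

section FibrationCriterion

universe v₁ v₂ u₁ u₂

variable {B : Type u₁} {E : Type u₂} [Category.{v₁} B] [Category.{v₂} E] (p : E ⥤ B)

/-- A product cone in a fibre, universal also for the arrows of the total category that lie over
arbitrary arrows into the base point. -/
structure IsStrongProduct {b : B} {P A A' : p.Fiber b} (π : P ⟶ A) (π' : P ⟶ A') : Prop where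
  exists_lift : ∀ {Y : B} {Z : E} (f : Y ⟶ b) (φ : Z ⟶ A.1) (φ' : Z ⟶ A'.1) [p.IsHomLift f φ]
    [p.IsHomLift f φ'], ∃ ψ : Z ⟶ P.1, p.IsHomLift f ψ ∧ ψ ≫ π.1 = φ ∧ ψ ≫ π'.1 = φ'
  ext : ∀ {Y : B} {Z : E} (f : Y ⟶ b) (ψ ψ' : Z ⟶ P.1) [p.IsHomLift f ψ] [p.IsHomLift f ψ'],
    ψ ≫ π.1 = ψ' ≫ π.1 → ψ ≫ π'.1 = ψ' ≫ π'.1 → ψ = ψ'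

/-- An object of a fibre that is terminal also for the arrows of the total category that lie over
arbitrary arrows into the base point. -/
structure IsStrongTerminal {b : B} (T : p.Fiber b) : Prop where
  existsUnique_lift : ∀ {Y : B} {Z : E} (f : Y ⟶ b), p.obj Z = Y → ∃! φ : Z ⟶ T.1, p.IsHomLift f φ

/-- The fibres of `p` have finite products in the strong sense, which makes reindexing preserve
them. -/
structure HasStrongProducts : Prop where
  exists_terminal : ∀ b : B, ∃ T : p.Fiber b, IsStrongTerminal p T
  exists_prod : ∀ (b : B) (A A' : p.Fiber b),
    ∃ (P : p.Fiber b) (π : P ⟶ A) (π' : P ⟶ A'), IsStrongProduct p π π'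

variable {p}

instance isHomLift_fiberHom {X : B} {A A' : p.Fiber X} (π : A ⟶ A') : p.IsHomLift (𝟙 X) π.1 :=
  π.2

instance isHomLift_id_fiber {X : B} (A : p.Fiber X) : p.IsHomLift (𝟙 X) (𝟙 A.1) :=
  IsHomLift.id A.2

theorem fiber_comp_val {X : B} {A A' A'' : p.Fiber X} (f : A ⟶ A') (g : A' ⟶ A'') :
    (f ≫ g).1 = f.1 ≫ g.1 := rfl

theorem fiber_id_val {X : B} (A : p.Fiber X) : Subtype.val (𝟙 A) = 𝟙 A.1 := rfl

namespace IsStrongProduct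

variable {b : B} {P A A' : p.Fiber b} {π : P ⟶ A} {π' : P ⟶ A'}

theorem nonempty_isLimit (h : IsStrongProduct p π π') :
    Nonempty (IsLimit (BinaryFan.mk π π')) := by
  have exists_lift (T : p.Fiber b) (f : T ⟶ A) (g : T ⟶ A') :
      ∃ l : T ⟶ P, l ≫ π = f ∧ l ≫ π' = g := by
    obtain ⟨ψ, hψ, hπ, hπ'⟩ := h.exists_lift (𝟙 b) f.1 g.1
    exact ⟨⟨ψ, hψ⟩, Subtype.ext hπ, Subtype.ext hπ'⟩
  choose l hl hl' using exists_lift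
  exact ⟨BinaryFan.IsLimit.mk _ (fun f g => l _ f g) (fun f g => hl _ f g) (fun f g => hl' _ f g)
    fun f g m hm hm' => Subtype.ext <| h.ext (𝟙 b) m.1 (l _ f g).1
      (congrArg Subtype.val (hm.trans (hl _ f g).symm))
      (congrArg Subtype.val (hm'.trans (hl' _ f g).symm))⟩

theorem of_isLimit (h : IsStrongProduct p π π') {Q : p.Fiber b} {ρ : Q ⟶ A} {ρ' : Q ⟶ A'}
    (hQ : IsLimit (BinaryFan.mk ρ ρ')) : IsStrongProduct p ρ ρ' := by
  obtain ⟨hP⟩ := h.nonempty_isLimit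
  obtain ⟨i, hi, hi'⟩ : ∃ i : P ≅ Q, i.hom ≫ ρ = π ∧ i.hom ≫ ρ' = π' :=
    ⟨hP.conePointUniqueUpToIso hQ,
      hP.conePointUniqueUpToIso_hom_comp hQ ⟨WalkingPair.left⟩,
      hP.conePointUniqueUpToIso_hom_comp hQ ⟨WalkingPair.right⟩⟩
  have e : i.inv ≫ π = ρ := by rw [← hi, Iso.inv_hom_id_assoc]
  have e' : i.inv ≫ π' = ρ' := by rw [← hi', Iso.inv_hom_id_assoc]
  refine ⟨fun f φ φ' _ _ => ?_, fun f ψ ψ' _ _ hh hh' => ?_⟩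
  · obtain ⟨ψ, _, h₁, h₂⟩ := h.exists_lift f φ φ'
    refine ⟨ψ ≫ i.hom.1, inferInstance, ?_, ?_⟩
    · rw [Category.assoc, ← fiber_comp_val, hi, h₁]
    · rw [Category.assoc, ← fiber_comp_val, hi', h₂]
  · have inv_eq : ψ ≫ i.inv.1 = ψ' ≫ i.inv.1 := by
      refine h.ext f _ _ ?_ ?_
      · simpa only [Category.assoc, ← fiber_comp_val, e] using hh
      · simpa only [Category.assoc, ← fiber_comp_val, e'] using hh'
    simpa only [Category.assoc, ← fiber_comp_val, Iso.inv_hom_id, fiber_id_val,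
      Category.comp_id] using congrArg (· ≫ i.hom.1) inv_eq

end IsStrongProduct

theorem IsStrongTerminal.nonempty_isTerminal {b : B} {T : p.Fiber b} (h : IsStrongTerminal p T) :
    Nonempty (IsTerminal T) := by
  have exists_unique_hom (A : p.Fiber b) : ∃ φ : A ⟶ T, ∀ ψ : A ⟶ T, ψ = φ := by
    obtain ⟨φ, hφ, huniq⟩ := h.existsUnique_lift (𝟙 b) A.2
    exact ⟨⟨φ, hφ⟩, fun ψ => Subtype.ext (huniq ψ.1 ψ.2)⟩
  choose l hl using exists_unique_hom
  exact ⟨IsTerminal.ofUniqueHom l hl⟩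

theorem HasStrongProducts.hasFiniteProducts_fiber (h : HasStrongProducts p) (b : B) :
    HasFiniteProducts (p.Fiber b) := by
  obtain ⟨T, hT⟩ := h.exists_terminal b
  have := hT.nonempty_isTerminal.some.hasTerminal
  have {A A' : p.Fiber b} : HasLimit (pair A A') := by
    obtain ⟨P, π, π', hP⟩ := h.exists_prod b A A'
    exact ⟨⟨⟨_, hP.nonempty_isLimit.some⟩⟩⟩
  have := hasBinaryProducts_of_hasLimit_pair (p.Fiber b)
  exact hasFiniteProducts_of_has_binary_and_terminal

theorem isIso_of_isCocartesian_comp {X Y : B} (d : X ⟶ Y) {A : p.Fiber X} {S Q : p.Fiber Y}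
    (η : A.1 ⟶ S.1) [p.IsCocartesian d η] (F : S ⟶ Q) [p.IsCocartesian d (η ≫ F.1)] :
    IsIso F := by
  let G : Q ⟶ S := ⟨Functor.IsCocartesian.map p d (η ≫ F.1) η, inferInstance⟩
  have hG : (η ≫ F.1) ≫ G.1 = η := Functor.IsCocartesian.fac p d (η ≫ F.1) η
  refine ⟨G, Subtype.ext ?_, Subtype.ext ?_⟩
  · exact Functor.IsCocartesian.ext p d η _ _ (by
      rw [fiber_comp_val, ← Category.assoc, hG, fiber_id_val, Category.comp_id])
  · exact Functor.IsCocartesian.ext p d (η ≫ F.1) _ _ (by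
      rw [fiber_comp_val, ← Category.assoc, hG, fiber_id_val, Category.comp_id])

section Reindexing

variable [p.IsFibered]

/-- The chosen cartesian arrow `f^* A ⟶ A`: `cartLift`, with its domain written as a value of the
reindexing functor. -/
noncomputable def cartMap {X Y : B} (f : X ⟶ Y) (A : p.Fiber Y) :
    ((reindex p f).obj A).1 ⟶ A.1 :=
  cartLift p f A

instance isStronglyCartesian_cartMap {X Y : B} (f : X ⟶ Y) (A : p.Fiber Y) :
    p.IsStronglyCartesian f (cartMap f A) :=
  inferInstanceAs (p.IsStronglyCartesian f (cartLift p f A))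

theorem reindex_map_fac {X Y : B} (f : X ⟶ Y) {A A' : p.Fiber Y} (φ : A ⟶ A') :
    ((reindex p f).map φ).1 ≫ cartMap f A' = cartMap f A ≫ φ.1 :=
  vertLift_fac p f _ _

theorem IsStrongProduct.reindex {X Y : B} (f : X ⟶ Y) {P A A' : p.Fiber Y} {π : P ⟶ A}
    {π' : P ⟶ A'} (h : IsStrongProduct p π π') :
    IsStrongProduct p ((reindex p f).map π) ((reindex p f).map π') := by
  refine ⟨fun g φ φ' _ _ => ?_, fun g ψ ψ' _ _ hψ hψ' => ?_⟩
  · obtain ⟨ψ₀, _, h₁, h₂⟩ := h.exists_lift (g ≫ f) (φ ≫ cartMap f A) (φ' ≫ cartMap f A')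
    have hg : g ≫ f = g ≫ f := rfl
    let ψ := Functor.IsStronglyCartesian.map p f (cartMap f P) hg ψ₀
    have : p.IsHomLift g ψ := Functor.IsStronglyCartesian.map_isHomLift p f (cartMap f P) hg ψ₀
    have hψ : ψ ≫ cartMap f P = ψ₀ := Functor.IsStronglyCartesian.fac p f (cartMap f P) hg ψ₀
    refine ⟨ψ, this, Functor.IsStronglyCartesian.ext p f (cartMap f A) g ?_,
      Functor.IsStronglyCartesian.ext p f (cartMap f A') g ?_⟩
    · rw [Category.assoc, reindex_map_fac, ← Category.assoc, hψ, h₁]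
    · rw [Category.assoc, reindex_map_fac, ← Category.assoc, hψ, h₂]
  · refine Functor.IsStronglyCartesian.ext p f (cartMap f P) g (h.ext (g ≫ f) _ _ ?_ ?_)
    · rw [Category.assoc, Category.assoc, ← reindex_map_fac, ← Category.assoc, ← Category.assoc,
        hψ]
    · rw [Category.assoc, Category.assoc, ← reindex_map_fac, ← Category.assoc, ← Category.assoc,
        hψ']

theorem IsStrongTerminal.reindex {X Y : B} (f : X ⟶ Y) {T : p.Fiber Y} (h : IsStrongTerminal p T) :
    IsStrongTerminal p ((reindex p f).obj T) := by
  refine ⟨fun g hZ => ?_⟩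
  obtain ⟨φ, _, huniq⟩ := h.existsUnique_lift (g ≫ f) hZ
  refine ⟨Functor.IsStronglyCartesian.map p f (cartMap f T) rfl φ,
    Functor.IsStronglyCartesian.map_isHomLift p f (cartMap f T) rfl φ, fun ψ _ => ?_⟩
  exact Functor.IsStronglyCartesian.map_uniq p f (cartMap f T) rfl φ ψ
    (huniq (ψ ≫ cartMap f T) inferInstance)

namespace HasStrongProducts

theorem preservesTerminal_reindex (h : HasStrongProducts p) {X Y : B} (f : X ⟶ Y) :
    PreservesLimitsOfShape (Discrete PEmpty.{1}) (reindex p f) := by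
  have := h.hasFiniteProducts_fiber
  obtain ⟨T, hT⟩ := h.exists_terminal Y
  have i : (reindex p f).obj (⊤_ p.Fiber Y) ≅ ⊤_ p.Fiber X :=
    (reindex p f).mapIso (terminalIsTerminal.uniqueUpToIso hT.nonempty_isTerminal.some) ≪≫
      (hT.reindex f).nonempty_isTerminal.some.uniqueUpToIso terminalIsTerminal
  have := preservesTerminal_of_iso (reindex p f) i
  exact preservesLimitsOfShape_pempty_of_preservesTerminal _

theorem preservesBinaryProducts_reindex (h : HasStrongProducts p) {X Y : B} (f : X ⟶ Y) :
    PreservesLimitsOfShape (Discrete WalkingPair) (reindex p f) := by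
  refine ⟨fun {K} => ?_⟩
  obtain ⟨P, π, π', hP⟩ := h.exists_prod Y (K.obj ⟨WalkingPair.left⟩) (K.obj ⟨WalkingPair.right⟩)
  have : PreservesLimit (pair (K.obj ⟨WalkingPair.left⟩) (K.obj ⟨WalkingPair.right⟩))
      (reindex p f) :=
    preservesLimit_of_preserves_limit_cone hP.nonempty_isLimit.some
      ((isLimitMapConeBinaryFanEquiv (reindex p f) π π').symm
        (hP.reindex f).nonempty_isLimit.some)
  exact preservesLimit_of_iso_diagram _ (diagramIsoPair K).symm

theorem isFibrationWithProducts [HasFiniteProducts B] (h : HasStrongProducts p) :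
    IsFibrationWithProducts p := by
  have := h.hasFiniteProducts_fiber
  refine ⟨inferInstance, inferInstance, this, fun f => ?_⟩
  have := h.preservesTerminal_reindex f
  have := h.preservesBinaryProducts_reindex f
  exact PreservesFiniteProducts.of_preserves_binary_and_terminal _

end HasStrongProducts

/-- Transposition along a cocartesian arrow `A ⟶ S` over `d`: arrows `S ⟶ C` over `𝟙 Y`, arrows
`A ⟶ C` over `d` and arrows `A ⟶ d^* C` over `𝟙 X` correspond. -/
noncomputable def cocartesianTranspose {X Y : B} (d : X ⟶ Y) {A : p.Fiber X} {S : p.Fiber Y}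
    (η : A.1 ⟶ S.1) [p.IsCocartesian d η] (C : p.Fiber Y) :
    (S ⟶ C) ≃ (A ⟶ (reindex p d).obj C) where
  toFun ψ := vertLift p d (η ≫ ψ.1) inferInstance
  invFun χ := ⟨Functor.IsCocartesian.map p d η (χ.1 ≫ cartMap d C), inferInstance⟩
  left_inv ψ := Subtype.ext
    (Functor.IsCocartesian.map_uniq p d η _ ψ.1 (vertLift_fac p d (η ≫ ψ.1) _).symm).symm
  right_inv χ := by
    apply vert_ext
    rw [vertLift_fac]
    exact Functor.IsCocartesian.fac p d η (χ.1 ≫ cartMap d C)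

theorem cocartesianTranspose_fac {X Y : B} (d : X ⟶ Y) {A : p.Fiber X} {S : p.Fiber Y}
    (η : A.1 ⟶ S.1) [p.IsCocartesian d η] {C : p.Fiber Y} (ψ : S ⟶ C) :
    (cocartesianTranspose d η C ψ).1 ≫ cartMap d C = η ≫ ψ.1 :=
  vertLift_fac p d _ _

section LeftAdjoint

variable {X Y : B} {d : X ⟶ Y} {S : p.Fiber X ⥤ p.Fiber Y}

/-- The arrow `A ⟶ Σ A` over `d` given by the unit of an adjunction `Σ ⊣ d^*`. -/
noncomputable def cocartMap (adj : S ⊣ reindex p d) (A : p.Fiber X) : A.1 ⟶ (S.obj A).1 :=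
  (adj.unit.app A).1 ≫ cartMap d (S.obj A)

instance isHomLift_cocartMap (adj : S ⊣ reindex p d) (A : p.Fiber X) :
    p.IsHomLift d (cocartMap adj A) :=
  inferInstanceAs (p.IsHomLift d ((adj.unit.app A).1 ≫ cartMap d (S.obj A)))

theorem homEquiv_comp_cartMap (adj : S ⊣ reindex p d) {A : p.Fiber X} {C : p.Fiber Y}
    (ψ : S.obj A ⟶ C) :
    (adj.homEquiv A C ψ).1 ≫ cartMap d C = cocartMap adj A ≫ ψ.1 := by
  rw [Adjunction.homEquiv_unit, fiber_comp_val, Category.assoc, reindex_map_fac, cocartMap,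
    Category.assoc]

theorem cocartMap_comp_map (adj : S ⊣ reindex p d) {A A' : p.Fiber X} (φ : A ⟶ A') :
    cocartMap adj A ≫ (S.map φ).1 = φ.1 ≫ cocartMap adj A' := by
  have e : adj.homEquiv _ _ (S.map φ) = φ ≫ adj.unit.app A' := by
    rw [adj.homEquiv_unit]
    exact adj.unit_naturality φ
  rw [← homEquiv_comp_cartMap, e, fiber_comp_val, Category.assoc, cocartMap]

theorem exists_adjunction_reindex {D : ∀ {A : p.Fiber X} {S : p.Fiber Y}, (A.1 ⟶ S.1) → Prop}
    (isCocartesian : ∀ {A : p.Fiber X} {S : p.Fiber Y} {η : A.1 ⟶ S.1}, D η → p.IsCocartesian d η)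
    (exists_arrow : ∀ A : p.Fiber X, ∃ (S : p.Fiber Y) (η : A.1 ⟶ S.1), D η) :
    ∃ (S : p.Fiber X ⥤ p.Fiber Y) (adj : S ⊣ reindex p d), ∀ A, D (cocartMap adj A) := by
  choose S η hD using exists_arrow
  have (A : p.Fiber X) : p.IsCocartesian d (η A) := isCocartesian (hD A)
  have natural {A : p.Fiber X} {C C' : p.Fiber Y} (g : C ⟶ C') (h : S A ⟶ C) :
      cocartesianTranspose d (η A) C' (h ≫ g) =
        cocartesianTranspose d (η A) C h ≫ (reindex p d).map g := by
    apply vert_ext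
    refine (cocartesianTranspose_fac d (η A) (h ≫ g)).trans ?_
    change _ = (_ ≫ _) ≫ cartMap d C'
    rw [Category.assoc, reindex_map_fac, ← Category.assoc, cocartesianTranspose_fac,
      Category.assoc, fiber_comp_val]
  let adj := Adjunction.adjunctionOfEquivLeft (fun A C => cocartesianTranspose d (η A) C)
    fun _ _ _ g h => natural g h
  refine ⟨_, adj, fun A => ?_⟩
  have unit_eq : adj.unit.app A = cocartesianTranspose d (η A) (S A) (𝟙 (S A)) := rfl
  have cocartMap_eq : cocartMap adj A = η A :=
    (congrArg (fun χ => χ.1 ≫ cartMap d (S A)) unit_eq).trans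
      ((cocartesianTranspose_fac d (η A) (𝟙 (S A))).trans (Category.comp_id _))
  exact cocartMap_eq ▸ hD A

theorem cocartMap_comp_beckChevalleyMap (adj : S ⊣ reindex p d) {X' Y' : B} {d' : X' ⟶ Y'}
    {f : X ⟶ X'} {g : Y ⟶ Y'} (sq : f ≫ d' = d ≫ g) {S' : p.Fiber X' ⥤ p.Fiber Y'}
    (adj' : S' ⊣ reindex p d') (A : p.Fiber X') :
    (cocartMap adj _ ≫ (beckChevalleyMap p sq adj adj' A).1) ≫ cartMap g (S'.obj A) =
      cartMap f A ≫ cocartMap adj' A := by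
  have reindexComm_fac : (reindexComm p sq (S'.obj A)).1 ≫ cartMap d _ ≫ cartMap g (S'.obj A) =
      cartMap f ((reindex p d').obj (S'.obj A)) ≫ cartMap d' (S'.obj A) :=
    (Category.assoc _ _ _).symm.trans <|
      (congrArg (· ≫ cartMap g (S'.obj A)) (vertLift_fac p d _ _)).trans
        (Functor.IsStronglyCartesian.fac p g (cartLift p g (S'.obj A)) sq
          (cartLift p f (reindexObj p d' (S'.obj A)) ≫ cartLift p d' (S'.obj A)))
  rw [← homEquiv_comp_cartMap, beckChevalleyMap, Equiv.apply_symm_apply, fiber_comp_val,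
    Category.assoc, Category.assoc, reindexComm_fac, ← Category.assoc]
  exact (congrArg (· ≫ _) (reindex_map_fac f (adj'.unit.app A))).trans (Category.assoc _ _ _)

theorem cocartMap_comp_frobeniusMap_fst [IsFibrationWithProducts p] (adj : S ⊣ reindex p d)
    (A : p.Fiber X) (C : p.Fiber Y) :
    (cocartMap adj _ ≫ (frobeniusMap p adj A C).1) ≫ (prod.fst : C ⨯ S.obj A ⟶ C).1 =
      (prod.fst : (reindex p d).obj C ⨯ A ⟶ _).1 ≫ cartMap d C := by
  rw [Category.assoc, ← fiber_comp_val, frobeniusMap, prod.lift_fst, ← homEquiv_comp_cartMap,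
    ← Adjunction.homEquiv_counit, Equiv.apply_symm_apply]

theorem cocartMap_comp_frobeniusMap_snd [IsFibrationWithProducts p] (adj : S ⊣ reindex p d)
    (A : p.Fiber X) (C : p.Fiber Y) :
    (cocartMap adj _ ≫ (frobeniusMap p adj A C).1) ≫ (prod.snd : C ⨯ S.obj A ⟶ S.obj A).1 =
      (prod.snd : (reindex p d).obj C ⨯ A ⟶ _).1 ≫ cocartMap adj A := by
  rw [Category.assoc, ← fiber_comp_val, frobeniusMap, prod.lift_snd, cocartMap_comp_map]

end LeftAdjoint

end Reindexing

section Criterion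

variable [HasFiniteProducts B]

variable (p) in
/-- A class of cocartesian arrows over the parametrised diagonals that contains an arrow out of
every object and is stable under products with cartesian arrows and under reindexing in the
parameter. -/
structure IsDiagonalClass
    (D : ∀ {Y X : B} {A : p.Fiber (Y ⨯ X)} {S : p.Fiber ((Y ⨯ X) ⨯ X)}, (A.1 ⟶ S.1) → Prop) :
    Prop where
  isCocartesian : ∀ {Y X : B} {A : p.Fiber (Y ⨯ X)} {S : p.Fiber ((Y ⨯ X) ⨯ X)} {η : A.1 ⟶ S.1},
    D η → p.IsCocartesian (paramDiag Y X) η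
  exists_arrow : ∀ {Y X : B} (A : p.Fiber (Y ⨯ X)),
    ∃ (S : p.Fiber ((Y ⨯ X) ⨯ X)) (η : A.1 ⟶ S.1), D η
  frobenius : ∀ {Y X : B} {A C' P : p.Fiber (Y ⨯ X)} {S C Q : p.Fiber ((Y ⨯ X) ⨯ X)} {η : A.1 ⟶ S.1}
    (_ : D η) (γ : C'.1 ⟶ C.1) [p.IsStronglyCartesian (paramDiag Y X) γ]
    {π : P ⟶ C'} {π' : P ⟶ A} (_ : IsStrongProduct p π π')
    {ρ : Q ⟶ C} {ρ' : Q ⟶ S} (_ : IsStrongProduct p ρ ρ')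
    (κ : P.1 ⟶ Q.1) [p.IsHomLift (paramDiag Y X) κ],
    κ ≫ ρ.1 = π.1 ≫ γ → κ ≫ ρ'.1 = π'.1 ≫ η → D κ
  beckChevalley : ∀ {Y Z : B} (f : Y ⟶ Z) {X : B} {A : p.Fiber (Z ⨯ X)} {S : p.Fiber ((Z ⨯ X) ⨯ X)}
    {A' : p.Fiber (Y ⨯ X)} {S' : p.Fiber ((Y ⨯ X) ⨯ X)} {η : A.1 ⟶ S.1} (_ : D η)
    (α : A'.1 ⟶ A.1) [p.IsStronglyCartesian (prod.map f (𝟙 X)) α]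
    (σ : S'.1 ⟶ S.1) [p.IsStronglyCartesian (prod.map (prod.map f (𝟙 X)) (𝟙 X)) σ]
    (η' : A'.1 ⟶ S'.1) [p.IsHomLift (paramDiag Y X) η'], η' ≫ σ = α ≫ η → D η'

theorem IsDiagonalClass.isElementary [p.IsFibered] (hp : HasStrongProducts p)
    {D : ∀ {Y X : B} {A : p.Fiber (Y ⨯ X)} {S : p.Fiber ((Y ⨯ X) ⨯ X)}, (A.1 ⟶ S.1) → Prop}
    (hD : IsDiagonalClass p D) : IsElementary p := by
  have hfib := hp.isFibrationWithProducts
  choose S adj hadj using fun Y X : B =>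
    exists_adjunction_reindex (D := D) (d := paramDiag Y X) hD.isCocartesian hD.exists_arrow
  have isCocartesian (Y X A) := hD.isCocartesian (hadj Y X A)
  refine ⟨hfib, S, adj, fun Y X A C => ?_, fun {Y Z} f X A => ?_⟩
  · obtain ⟨P, π, π', hP⟩ := hp.exists_prod _ ((reindex p (paramDiag Y X)).obj C) A
    obtain ⟨Q, ρ, ρ', hQ⟩ := hp.exists_prod _ C ((S Y X).obj A)
    have := hD.isCocartesian <| hD.frobenius (hadj Y X A) (cartMap _ C)
      (hP.of_isLimit (prodIsProd _ _)) (hQ.of_isLimit (prodIsProd _ _))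
      (cocartMap (adj Y X) _ ≫ (frobeniusMap p (adj Y X) A C).1)
      (cocartMap_comp_frobeniusMap_fst _ A C) (cocartMap_comp_frobeniusMap_snd _ A C)
    exact isIso_of_isCocartesian_comp (paramDiag Y X) (cocartMap (adj Y X) _) _
  · have := hD.isCocartesian <| hD.beckChevalley f (hadj Z X A) (cartMap _ A)
      (cartMap (prod.map (prod.map f (𝟙 X)) (𝟙 X)) _)
      (cocartMap (adj Y X) _ ≫ (beckChevalleyMap p (paramDiag_square f X) (adj Y X) (adj Z X) A).1)
      (cocartMap_comp_beckChevalleyMap _ _ _ A)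
    exact isIso_of_isCocartesian_comp (paramDiag Y X) (cocartMap (adj Y X) _) _

end Criterion

end FibrationCriterion

section JointPullback

universe w v

variable {C : Type u} [Category.{v} C] {ι : Type w} {P I : C} {X J : ι → C}

/-- A cone of commutative squares `l i ≫ r i = q ≫ f i`, all with the same left side `q`, which is
universal among such cones: the limit of the cospans `(f i, r i)` glued along the common domain
of the `f i`. For `ι` empty it says that `q` is an isomorphism; for `ι` a point it is a pullback. -/
structure IsJointPullback (q : P ⟶ I) (l : ∀ i, P ⟶ X i) (f : ∀ i, I ⟶ J i)
    (r : ∀ i, X i ⟶ J i) : Prop where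
  w : ∀ i, l i ≫ r i = q ≫ f i
  existsUnique_lift : ∀ {Z : C} (b : Z ⟶ I) (x : ∀ i, Z ⟶ X i), (∀ i, x i ≫ r i = b ≫ f i) →
    ∃! m : Z ⟶ P, m ≫ q = b ∧ ∀ i, m ≫ l i = x i

namespace IsJointPullback

variable {q : P ⟶ I} {l : ∀ i, P ⟶ X i} {f : ∀ i, I ⟶ J i} {r : ∀ i, X i ⟶ J i}

theorem hom_ext (h : IsJointPullback q l f r) {Z : C} {m m' : Z ⟶ P} (hq : m ≫ q = m' ≫ q)
    (hl : ∀ i, m ≫ l i = m' ≫ l i) : m = m' :=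
  (h.existsUnique_lift (m' ≫ q) (fun i => m' ≫ l i) fun i => by
    rw [Category.assoc, Category.assoc, h.w]).unique ⟨hq, hl⟩ ⟨rfl, fun _ => rfl⟩

theorem of_widePullback (f : ∀ i, I ⟶ J i) (r : ∀ i, X i ⟶ J i) [∀ i, HasPullback (r i) (f i)]
    [HasWidePullback I _ fun i => pullback.snd (r i) (f i)] :
    IsJointPullback (WidePullback.base fun i => pullback.snd (r i) (f i))
      (fun i => WidePullback.π (fun i => pullback.snd (r i) (f i)) i ≫ pullback.fst (r i) (f i))
      f r where
  w i := by rw [Category.assoc, pullback.condition, ← Category.assoc, WidePullback.π_arrow]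
  existsUnique_lift b x hx := by
    let y i := pullback.lift (x i) b (hx i)
    have hy i : y i ≫ pullback.snd (r i) (f i) = b := pullback.lift_snd _ _ _
    refine ⟨WidePullback.lift b y hy, ⟨WidePullback.lift_base _ _ _ _, fun i => ?_⟩,
      fun m ⟨hmq, hml⟩ => WidePullback.hom_ext _ _ _ (fun i => ?_)
        (hmq.trans (WidePullback.lift_base _ _ _ _).symm)⟩
    · rw [← Category.assoc, WidePullback.lift_π, pullback.lift_fst]
    · rw [WidePullback.lift_π]
      refine pullback.hom_ext ?_ ?_
      · rw [Category.assoc, hml, pullback.lift_fst]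
      · rw [Category.assoc, WidePullback.π_arrow, hmq, hy]

end IsJointPullback

end JointPullback

section CartesianCone

universe w v₁ v₂ u₁ u₂

variable {B : Type u₁} {E : Type u₂} [Category.{v₁} B] [Category.{v₂} E] {p : E ⥤ B}
  {I : B} {P : p.Fiber I}

variable (p) in
/-- A cone of arrows `γ i` over `f i`, universal with respect to arrows over any `k` into the common
domain of the `f i`. It is a terminal object of the fibre if `ι` is empty, a cartesian arrow if `ι`
is a point, and a product in the fibre if every `f i` is an identity. -/
structure IsCartesianCone {ι : Type w} {J : ι → B} (f : ∀ i, I ⟶ J i) {A : ∀ i, p.Fiber (J i)}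
    (γ : ∀ i, P.1 ⟶ (A i).1) : Prop where
  isHomLift : ∀ i, p.IsHomLift (f i) (γ i)
  existsUnique_lift : ∀ {K : B} (k : K ⟶ I) {Z : p.Fiber K} (φ : ∀ i, Z.1 ⟶ (A i).1),
    (∀ i, p.IsHomLift (k ≫ f i) (φ i)) →
      ∃! χ : Z.1 ⟶ P.1, p.IsHomLift k χ ∧ ∀ i, χ ≫ γ i = φ i

namespace IsCartesianCone

theorem hom_ext {ι : Type w} {J : ι → B} {f : ∀ i, I ⟶ J i} {A : ∀ i, p.Fiber (J i)}
    {γ : ∀ i, P.1 ⟶ (A i).1} (h : IsCartesianCone p f γ) {K : B} (k : K ⟶ I) {Z : p.Fiber K}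
    {χ χ' : Z.1 ⟶ P.1} [p.IsHomLift k χ] [p.IsHomLift k χ'] (e : ∀ i, χ ≫ γ i = χ' ≫ γ i) :
    χ = χ' :=
  have := h.isHomLift
  (h.existsUnique_lift k (fun i => χ' ≫ γ i) fun _ => inferInstance).unique
    ⟨inferInstance, e⟩ ⟨inferInstance, fun _ => rfl⟩

theorem isStrongTerminal {J : Empty → B} {f : ∀ i, I ⟶ J i} {A : ∀ i, p.Fiber (J i)}
    {γ : ∀ i, P.1 ⟶ (A i).1} (h : IsCartesianCone p f γ) : IsStrongTerminal p P where
  existsUnique_lift {Y Z} k hZ := by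
    obtain ⟨χ, hχ, huniq⟩ := h.existsUnique_lift k (Z := ⟨Z, hZ⟩) isEmptyElim isEmptyElim
    exact ⟨χ, hχ.1, fun ψ hψ => huniq ψ ⟨hψ, isEmptyElim⟩⟩

theorem isStronglyCartesian {J : B} {f : I ⟶ J} {A : p.Fiber J} {γ : P.1 ⟶ A.1}
    (h : IsCartesianCone (ι := Unit) p (fun _ => f) (fun _ => γ)) : p.IsStronglyCartesian f γ where
  toIsHomLift := h.isHomLift ()
  universal_property' {Z} k φ hφ := by
    obtain ⟨χ, hχ, huniq⟩ := h.existsUnique_lift k (Z := ⟨Z, rfl⟩) (fun _ => φ) fun _ => hφ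
    exact ⟨χ, ⟨hχ.1, hχ.2 ()⟩, fun ψ hψ => huniq ψ ⟨hψ.1, fun _ => hψ.2⟩⟩

theorem isStrongProduct {A : Bool → p.Fiber I} {γ : ∀ i, P.1 ⟶ (A i).1}
    (h : IsCartesianCone p (fun _ => 𝟙 I) γ) :
    IsStrongProduct (p := p) (A := A true) (A' := A false) ⟨γ true, h.isHomLift true⟩
      ⟨γ false, h.isHomLift false⟩ where
  exists_lift {Y Z} k φ φ' _ _ := by
    obtain ⟨χ, hχ, hχγ⟩ := h.existsUnique_lift k (Z := ⟨Z, IsHomLift.domain_eq p k φ⟩)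
      (Bool.rec φ' φ) (Bool.rec (by rwa [Category.comp_id]) (by rwa [Category.comp_id])) |>.exists
    exact ⟨χ, hχ, hχγ true, hχγ false⟩
  ext {Y Z} k ψ ψ' _ _ e e' :=
    h.hom_ext k (Z := ⟨Z, IsHomLift.domain_eq p k ψ⟩) (Bool.rec e' e)

end IsCartesianCone

end CartesianCone

namespace AWFS

universe v

variable {C : Type u} [Category.{v} C] (W : AWFS C)

section Unbundled

variable {X X' X'' J J' J'' : C}

/-- The middle object of the factorisation of an arrow. -/
def mid (q : X ⟶ J) : C := W.M.obj (Arrow.mk q)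

/-- The left factor of an arrow. -/
def leftMap (q : X ⟶ J) : X ⟶ W.mid q := W.lam.app (Arrow.mk q)

/-- The right factor of an arrow. -/
def rightMap (q : X ⟶ J) : W.mid q ⟶ J := W.rho.app (Arrow.mk q)

/-- The multiplication of the monad. -/
def mulMap (q : X ⟶ J) : W.mid (W.rightMap q) ⟶ W.mid q := W.mul (Arrow.mk q)

/-- The action of the factorisation on commutative squares. -/
def midMap {q : X ⟶ J} {q' : X' ⟶ J'} (l : X ⟶ X') (f : J ⟶ J') (w : l ≫ q' = q ≫ f) :
    W.mid q ⟶ W.mid q' :=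
  W.M.map (X := Arrow.mk q) (Y := Arrow.mk q') (Arrow.homMk l f w)

theorem leftMap_rightMap (q : X ⟶ J) : W.leftMap q ≫ W.rightMap q = q := W.fac _

theorem mulMap_rightMap (q : X ⟶ J) :
    W.mulMap q ≫ W.rightMap q = W.rightMap (W.rightMap q) := W.mul_rho _

variable {q : X ⟶ J} {q' : X' ⟶ J'} {q'' : X'' ⟶ J''} {l : X ⟶ X'} {f : J ⟶ J'}
  (w : l ≫ q' = q ≫ f)

theorem midMap_rightMap : W.midMap l f w ≫ W.rightMap q' = W.rightMap q ≫ f :=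
  W.rho.naturality (X := Arrow.mk q) (Y := Arrow.mk q') (Arrow.homMk l f w)

theorem leftMap_midMap : W.leftMap q ≫ W.midMap l f w = l ≫ W.leftMap q' :=
  (W.lam.naturality (X := Arrow.mk q) (Y := Arrow.mk q') (Arrow.homMk l f w)).symm

theorem midMap_midMap {l' : X' ⟶ X''} {f' : J' ⟶ J''} (w' : l' ≫ q'' = q' ≫ f')
    (w'' : (l ≫ l') ≫ q'' = q ≫ f ≫ f') :
    W.midMap l f w ≫ W.midMap l' f' w' = W.midMap (l ≫ l') (f ≫ f') w'' :=
  (W.M.map_comp (X := Arrow.mk q) (Y := Arrow.mk q') (Z := Arrow.mk q'') (Arrow.homMk l f w)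
    (Arrow.homMk l' f' w')).symm

theorem mulMap_midMap : W.mulMap q ≫ W.midMap l f w =
    W.midMap (W.midMap l f w) f (W.midMap_rightMap w) ≫ W.mulMap q' :=
  (W.mul_natural (f := Arrow.mk q) (g := Arrow.mk q') (Arrow.homMk l f w)).symm

end Unbundled

/-- An algebra for the monad of an algebraic weak factorisation system on an arrow with
codomain `J`. -/
structure AlgOn (J : C) where
  tot : C
  proj : tot ⟶ J
  str : W.mid proj ⟶ tot
  str_proj : str ≫ proj = W.rightMap proj
  lam_str : W.leftMap proj ≫ str = 𝟙 tot
  mul_str : W.mulMap proj ≫ str =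
    W.midMap str (𝟙 J) (str_proj.trans (Category.comp_id _).symm) ≫ str

namespace AlgOn

variable {W} {I J K : C}

/-- A commutative square over `f` compatible with the algebra structures. -/
structure IsHom (a : AlgOn W I) (c : AlgOn W J) (f : I ⟶ J) (l : a.tot ⟶ c.tot) : Prop where
  w : l ≫ c.proj = a.proj ≫ f
  map_str : W.midMap l f w ≫ c.str = a.str ≫ l

/-- The algebra for the monad attached to an algebra on an arrow. -/
def toAlgebra (a : AlgOn W J) : W.RAlg where
  A := Arrow.mk a.proj
  a := Arrow.homMk a.str (𝟙 J) (a.str_proj.trans (Category.comp_id _).symm)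
  unit := by
    ext
    · exact a.lam_str
    · exact Category.comp_id _
  assoc := by
    ext
    · exact a.mul_str
    · rfl

/-- An algebra as an object of the fibre. -/
def toFiber (a : AlgOn W J) : W.algFunctor.Fiber J := ⟨a.toAlgebra, rfl⟩

theorem exists_eq_toFiber (A : W.algFunctor.Fiber J) : ∃ a : AlgOn W J, A = a.toFiber := by
  obtain ⟨⟨⟨X, Y, F⟩, s, hu, ha⟩, h⟩ := A
  obtain rfl : Y = J := h
  have s_right : s.right = 𝟙 _ :=
    (Category.id_comp _).symm.trans (congrArg CommaMorphism.right hu)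
  have s_left : s.left ≫ F = W.rho.app (Arrow.mk F) :=
    s.w.trans ((congrArg (_ ≫ ·) s_right).trans (Category.comp_id _))
  have s_eq : s = Arrow.homMk s.left (𝟙 _) (s_left.trans (Category.comp_id _).symm) := by
    ext
    · rfl
    · exact s_right
  refine ⟨⟨X, F, s.left, s_left, congrArg CommaMorphism.left hu, ?_⟩, Subtype.ext ?_⟩
  · exact (congrArg CommaMorphism.left ha).trans (congrArg (fun t => W.M.map t ≫ s.left) s_eq)
  · change (Monad.Algebra.mk _ s hu ha : W.RAlg) = Monad.Algebra.mk _ _ _ _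
    congr 1

section Hom

variable {a : AlgOn W I} {c : AlgOn W J} {f : I ⟶ J}

/-- An algebra map, as an arrow in the category of algebras. -/
def IsHom.toHom {l : a.tot ⟶ c.tot} (h : IsHom a c f l) : a.toFiber.1 ⟶ c.toFiber.1 where
  f := Arrow.homMk l f h.w
  h := by
    ext
    · exact h.map_str
    · exact (Category.comp_id _).trans (Category.id_comp _).symm

theorem IsHom.isHomLift {l : a.tot ⟶ c.tot} (h : IsHom a c f l) :
    W.algFunctor.IsHomLift f h.toHom :=
  IsHomLift.map W.algFunctor h.toHom

/-- The upper side of the square underlying an arrow of algebras. -/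
def totMap (φ : a.toFiber.1 ⟶ c.toFiber.1) : a.tot ⟶ c.tot := φ.f.left

theorem totMap_comp {e : AlgOn W K} (φ : a.toFiber.1 ⟶ c.toFiber.1)
    (ψ : c.toFiber.1 ⟶ e.toFiber.1) : totMap (φ ≫ ψ) = totMap φ ≫ totMap ψ := rfl

theorem isHom_right_totMap (φ : a.toFiber.1 ⟶ c.toFiber.1) : IsHom a c φ.f.right (totMap φ) :=
  ⟨φ.f.w, congrArg CommaMorphism.left φ.h⟩

variable (f)

theorem right_eq_of_isHomLift (φ : a.toFiber.1 ⟶ c.toFiber.1) [W.algFunctor.IsHomLift f φ] :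
    φ.f.right = f :=
  (@IsHomLift.eq_of_isHomLift _ _ _ _ W.algFunctor a.toFiber.1 c.toFiber.1 f φ ‹_›).symm

theorem isHom_totMap (φ : a.toFiber.1 ⟶ c.toFiber.1) [W.algFunctor.IsHomLift f φ] :
    IsHom a c f (totMap φ) :=
  right_eq_of_isHomLift f φ ▸ isHom_right_totMap φ

theorem hom_ext {φ ψ : a.toFiber.1 ⟶ c.toFiber.1} [W.algFunctor.IsHomLift f φ]
    [W.algFunctor.IsHomLift f ψ] (h : totMap φ = totMap ψ) : φ = ψ := by
  refine Monad.Algebra.Hom.ext ?_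
  ext
  · exact h
  · exact (right_eq_of_isHomLift f φ).trans (right_eq_of_isHomLift f ψ).symm

end Hom

section JointPullback

universe w

variable {ι : Type w} {J : ι → C} {c : ∀ i, AlgOn W (J i)} {P : C} {q : P ⟶ I}
  {l : ∀ i, P ⟶ (c i).tot} {f : ∀ i, I ⟶ J i}

theorem exists_str (h : IsJointPullback q l f fun i => (c i).proj) :
    ∃ s : W.mid q ⟶ P, s ≫ q = W.rightMap q ∧
      ∀ i, s ≫ l i = W.midMap (l i) (f i) (h.w i) ≫ (c i).str :=
  (h.existsUnique_lift _ _ fun i => by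
    rw [Category.assoc, (c i).str_proj, midMap_rightMap]).exists

/-- The algebra structure on a joint pullback of algebras for which the legs are algebra maps. -/
noncomputable def ofJointPullback (h : IsJointPullback q l f fun i => (c i).proj) :
    AlgOn W I where
  tot := P
  proj := q
  str := (exists_str h).choose
  str_proj := (exists_str h).choose_spec.1
  lam_str := by
    obtain ⟨hq, hl⟩ := (exists_str h).choose_spec
    refine h.hom_ext ?_ fun i => ?_
    · rw [Category.assoc, hq, leftMap_rightMap, Category.id_comp]
    · rw [Category.assoc, hl, ← Category.assoc, leftMap_midMap, Category.assoc, (c i).lam_str,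
        Category.comp_id, Category.id_comp]
  mul_str := by
    obtain ⟨hq, hl⟩ := (exists_str h).choose_spec
    refine h.hom_ext ?_ fun i => ?_
    · rw [Category.assoc, Category.assoc]
      refine (congrArg (_ ≫ ·) hq).trans (.trans ?_ (congrArg (_ ≫ ·) hq.symm))
      rw [mulMap_rightMap, midMap_rightMap, Category.comp_id]
    · rw [Category.assoc, Category.assoc]
      refine (congrArg (_ ≫ ·) (hl i)).trans (.trans ?_ (congrArg (_ ≫ ·) (hl i).symm))
      rw [← Category.assoc, mulMap_midMap, Category.assoc,
        (c i).mul_str, ← Category.assoc, ← Category.assoc,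
        midMap_midMap (w'' := by rw [Category.assoc, (c i).str_proj, midMap_rightMap,
          Category.comp_id]),
        midMap_midMap (w'' := by rw [Category.assoc, h.w, ← Category.assoc, hq,
          Category.id_comp])]
      congr 2
      · exact (hl i).symm
      · rw [Category.comp_id, Category.id_comp]

theorem isHom_ofJointPullback (h : IsJointPullback q l f fun i => (c i).proj) (i : ι) :
    IsHom (ofJointPullback h) (c i) (f i) (l i) :=
  ⟨h.w i, ((exists_str h).choose_spec.2 i).symm⟩

theorem isHom_to_ofJointPullback (h : IsJointPullback q l f fun i => (c i).proj) {z : AlgOn W K}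
    {k : K ⟶ I} {m : z.tot ⟶ P} (hm : m ≫ q = z.proj ≫ k)
    (hml : ∀ i, IsHom z (c i) (k ≫ f i) (m ≫ l i)) : IsHom z (ofJointPullback h) k m := by
  obtain ⟨hq, hl⟩ := (exists_str h).choose_spec
  refine ⟨hm, h.hom_ext ?_ fun i => ?_⟩
  · calc (W.midMap m k hm ≫ _) ≫ q = W.midMap m k hm ≫ W.rightMap q :=
          (Category.assoc _ _ _).trans (congrArg (_ ≫ ·) hq)
      _ = z.str ≫ z.proj ≫ k := by rw [midMap_rightMap, ← Category.assoc, z.str_proj]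
      _ = (z.str ≫ m) ≫ q := by rw [← hm, Category.assoc]
  · calc (W.midMap m k hm ≫ _) ≫ l i =
          W.midMap m k hm ≫ W.midMap (l i) (f i) (h.w i) ≫ (c i).str :=
          (Category.assoc _ _ _).trans (congrArg (_ ≫ ·) (hl i))
      _ = W.midMap (m ≫ l i) (k ≫ f i) (hml i).w ≫ (c i).str := by
          rw [← Category.assoc, midMap_midMap]
      _ = (z.str ≫ m) ≫ l i := by rw [(hml i).map_str, Category.assoc]

theorem isCartesianCone_ofJointPullback (h : IsJointPullback q l f fun i => (c i).proj) :
    IsCartesianCone W.algFunctor (P := (ofJointPullback h).toFiber) (A := fun i => (c i).toFiber) f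
      fun i => (isHom_ofJointPullback h i).toHom where
  isHomLift i := (isHom_ofJointPullback h i).isHomLift
  existsUnique_lift {K} k {Z} φ hφ := by
    obtain ⟨z, rfl⟩ := exists_eq_toFiber Z
    have isHom_φ i := isHom_totMap (k ≫ f i) (φ i)
    obtain ⟨m, ⟨hm, hml⟩, huniq⟩ := h.existsUnique_lift (z.proj ≫ k) (fun i => totMap (φ i))
      fun i => (isHom_φ i).w.trans (Category.assoc _ _ _).symm
    have isHom_m : IsHom z (ofJointPullback h) k m :=
      isHom_to_ofJointPullback h hm fun i => (hml i).symm ▸ isHom_φ i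
    have := isHom_m.isHomLift
    refine ⟨isHom_m.toHom, ⟨this, fun i => ?_⟩, fun χ ⟨_, hχγ⟩ => ?_⟩
    · have := (isHom_ofJointPullback h i).isHomLift
      have : W.algFunctor.IsHomLift (k ≫ f i) (isHom_m.toHom ≫ (isHom_ofJointPullback h i).toHom) :=
        inferInstance
      exact hom_ext (k ≫ f i) (hml i)
    · exact hom_ext k (huniq _ ⟨(isHom_totMap k χ).w, fun i => congrArg totMap (hχγ i)⟩)

end JointPullback

end AlgOn

open AlgOn

variable [HasFiniteWidePullbacks C]

theorem exists_isCartesianCone {ι : Type} [Finite ι] {I : C} {J : ι → C} (f : ∀ i, I ⟶ J i)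
    (A : ∀ i, W.algFunctor.Fiber (J i)) :
    ∃ (P : W.algFunctor.Fiber I) (γ : ∀ i, P.1 ⟶ (A i).1), IsCartesianCone W.algFunctor f γ := by
  choose c hc using fun i => exists_eq_toFiber (A i)
  obtain rfl : A = fun i => (c i).toFiber := funext hc
  exact ⟨_, _, isCartesianCone_ofJointPullback (.of_widePullback f fun i => (c i).proj)⟩

theorem hasStrongProducts_algFunctor : HasStrongProducts W.algFunctor where
  exists_terminal J := by
    obtain ⟨P, γ, h⟩ := W.exists_isCartesianCone (ι := Empty) (I := J) (J := isEmptyElim)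
      isEmptyElim isEmptyElim
    exact ⟨P, h.isStrongTerminal⟩
  exists_prod J A A' := by
    obtain ⟨P, γ, h⟩ := W.exists_isCartesianCone (fun _ => 𝟙 J) (Bool.rec A' A)
    exact ⟨P, _, _, h.isStrongProduct⟩

theorem exists_isStronglyCartesian {I J : C} (f : I ⟶ J) (A : W.algFunctor.Fiber J) :
    ∃ (A' : W.RAlg) (γ : A' ⟶ A.1), W.algFunctor.IsStronglyCartesian f γ := by
  obtain ⟨P, γ, h⟩ := W.exists_isCartesianCone (fun _ : Unit => f) fun _ => A
  exact ⟨P.1, γ (), h.isStronglyCartesian⟩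

instance isFibered_algFunctor : W.algFunctor.IsFibered :=
  .of_exists_isStronglyCartesian fun A _ f => W.exists_isStronglyCartesian f ⟨A, rfl⟩

end AWFS

section Paths

/-- The groupoid of arrows of a groupoid. -/
def Path (J : Grpd.{u, u}) : Grpd.{u, u} := Grpd.of (PathObj (𝟭 J))

namespace Path

variable {J K L T : Grpd.{u, u}}

/-- The domain of an arrow. -/
def src (J : Grpd.{u, u}) : Path J ⟶ J := PathObj.baseFunctor (𝟭 J)

/-- The codomain of an arrow. -/
def tgt (J : Grpd.{u, u}) : Path J ⟶ J := PathObj.ptFunctor (𝟭 J)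

/-- The identity arrows. -/
def refl (J : Grpd.{u, u}) : J ⟶ Path J := PathObj.lam (𝟭 J)

/-- Functors into `Path J` are natural transformations. -/
def mk (b p : T ⥤ J) (α : ∀ t, b.obj t ⟶ p.obj t)
    (hα : ∀ {t t' : T} (f : t ⟶ t'), b.map f ≫ α t' = α t ≫ p.map f) : T ⟶ Path J :=
  PathObj.lift (F := 𝟭 J) b p α hα

/-- The component of a functor into `Path J`. -/
def app (w : T ⟶ Path J) (t : T) : (w ≫ src J).obj t ⟶ (w ≫ tgt J).obj t :=
  PathObj.iso (F := 𝟭 J) (w.obj t)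

theorem app_naturality (w : T ⟶ Path J) {t t' : T} (f : t ⟶ t') :
    (w ≫ src J).map f ≫ app w t' = app w t ≫ (w ≫ tgt J).map f :=
  PathObj.Hom.w (F := 𝟭 J) (w.map f)

theorem hext {w w' : T ⟶ Path J} (hs : w ≫ src J = w' ≫ src J) (ht : w ≫ tgt J = w' ≫ tgt J)
    (h : ∀ t, HEq (app w t) (app w' t)) : w = w' :=
  PathObj.functor_ext (X := T) (F := 𝟭 J) hs ht fun t =>
    eq_of_heq ((comp_eqToHom_heq (app w t) (Functor.congr_obj ht t)).trans
      ((h t).trans (eqToHom_comp_heq _ _).symm))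

/-- The action of a functor on arrows. -/
def map (f : J ⟶ K) : Path J ⟶ Path K :=
  mk (src J ≫ f) (tgt J ≫ f) (fun P => f.map (PathObj.iso P)) fun g =>
    (f.map_comp _ _).symm.trans ((congrArg f.map (PathObj.Hom.w g)).trans (f.map_comp _ _))

theorem map_src (f : J ⟶ K) : map f ≫ src K = src J ≫ f := rfl
theorem map_tgt (f : J ⟶ K) : map f ≫ tgt K = tgt J ≫ f := rfl
theorem refl_src (J : Grpd.{u, u}) : refl J ≫ src J = 𝟙 J := rfl
theorem refl_tgt (J : Grpd.{u, u}) : refl J ≫ tgt J = 𝟙 J := rfl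
theorem map_comp (f : J ⟶ K) (g : K ⟶ L) : map (f ≫ g) = map f ≫ map g := rfl
theorem map_id (J : Grpd.{u, u}) : map (𝟙 J) = 𝟙 (Path J) := rfl

theorem refl_map (f : J ⟶ K) : refl J ≫ map f = f ≫ refl K :=
  hext rfl rfl fun t => heq_of_eq (f.map_id t)

theorem comp_groupoidInv_eq {a b c d : J} {x : a ⟶ b} {y : c ⟶ d} {f : a ⟶ c} {g : b ⟶ d}
    (h : f ≫ y = x ≫ g) : g ≫ Groupoid.inv y = Groupoid.inv x ≫ f := by
  rw [Groupoid.inv_eq_inv, Groupoid.inv_eq_inv, IsIso.eq_inv_comp, ← Category.assoc,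
    IsIso.comp_inv_eq, h]

/-- The inversion of arrows, as a functor. -/
def inv (J : Grpd.{u, u}) : Path J ⟶ Path J :=
  mk (tgt J) (src J) (fun P => Groupoid.inv (PathObj.iso (F := 𝟭 J) P)) fun g =>
    comp_groupoidInv_eq (PathObj.Hom.w (F := 𝟭 J) g)

theorem inv_src (J : Grpd.{u, u}) : inv J ≫ src J = tgt J := rfl
theorem inv_tgt (J : Grpd.{u, u}) : inv J ≫ tgt J = src J := rfl

theorem refl_inv (J : Grpd.{u, u}) : refl J ≫ inv J = refl J :=
  hext rfl rfl fun t => heq_of_eq (by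
    change Groupoid.inv (𝟙 t) = 𝟙 t
    rw [Groupoid.inv_eq_inv, IsIso.inv_id])

/-- Pointwise composition. -/
def comp (w w' : T ⟶ Path J) (h : w ≫ tgt J = w' ≫ src J) : T ⟶ Path J :=
  mk (w ≫ src J) (w' ≫ tgt J) (fun t => app w t ≫ eqToHom (Functor.congr_obj h t) ≫ app w' t)
    fun {t t'} f => by
      rw [← Category.assoc, app_naturality, Functor.congr_hom h f]
      simp [app_naturality]

theorem comp_src (w w' : T ⟶ Path J) (h : w ≫ tgt J = w' ≫ src J) :
    comp w w' h ≫ src J = w ≫ src J := rfl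

theorem comp_tgt (w w' : T ⟶ Path J) (h : w ≫ tgt J = w' ≫ src J) :
    comp w w' h ≫ tgt J = w' ≫ tgt J := rfl

theorem precomp_comp {T' : Grpd.{u, u}} (m : T' ⟶ T) (w w' : T ⟶ Path J)
    (h : w ≫ tgt J = w' ≫ src J) :
    m ≫ comp w w' h = comp (m ≫ w) (m ≫ w') (by rw [Category.assoc, Category.assoc, h]) := rfl

theorem comp_map (w w' : T ⟶ Path J) (h : w ≫ tgt J = w' ≫ src J) (f : J ⟶ K) :
    comp w w' h ≫ map f = comp (w ≫ map f) (w' ≫ map f) (by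
      rw [Category.assoc, Category.assoc, map_tgt, map_src, ← Category.assoc, h,
        Category.assoc]) :=
  hext rfl rfl fun _ => heq_of_eq ((f.map_comp _ _).trans (congrArg (_ ≫ ·)
    ((f.map_comp _ _).trans (congrArg (· ≫ _) (eqToHom_map f _)))))

theorem comp_congr {w w' v v' : T ⟶ Path J} {h : w ≫ tgt J = w' ≫ src J} (e : w = v)
    (e' : w' = v') : comp w w' h = comp v v' (by rw [← e, ← e', h]) := by
  subst e e'
  rfl

theorem refl_comp (v w : T ⟶ Path J) (h) (hv : v = w ≫ src J ≫ refl J) : comp v w h = w := by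
  subst hv
  exact hext rfl rfl fun _ => heq_of_eq ((Category.id_comp _).trans (Category.id_comp _))

theorem comp_refl (w v : T ⟶ Path J) (h) (hv : v = w ≫ tgt J ≫ refl J) : comp w v h = w := by
  subst hv
  exact hext rfl rfl fun t =>
    heq_of_eq ((congrArg (app w t ≫ ·) (Category.id_comp _)).trans (Category.comp_id _))

theorem comp_assoc (w w' w'' : T ⟶ Path J) (h : w ≫ tgt J = w' ≫ src J)
    (h' : w' ≫ tgt J = w'' ≫ src J) :
    comp (comp w w' h) w'' (by rw [comp_tgt, h']) = comp w (comp w' w'' h') (by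
      rw [comp_src, h]) :=
  hext rfl rfl fun t => heq_of_eq
    ((Category.assoc _ _ _).trans (congrArg (app w t ≫ ·) (Category.assoc _ _ _)))

theorem comp_inv (w : T ⟶ Path J) :
    comp w (w ≫ inv J) (by rw [Category.assoc, inv_src]) = w ≫ src J ≫ refl J :=
  hext rfl rfl fun t => heq_of_eq
    ((congrArg (app w t ≫ ·) (Category.id_comp _)).trans (Groupoid.comp_inv _))

theorem comp_comp_inv (w w' : T ⟶ Path J) (h : w ≫ tgt J = w' ≫ src J) :
    comp w w' h ≫ inv J = comp (w' ≫ inv J) (w ≫ inv J) (by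
      rw [Category.assoc, Category.assoc, inv_tgt, inv_src, h]) := by
  have inv_comp_eqToHom_comp {a b c d : J} (x : a ⟶ b) (e : b = c) (y : c ⟶ d) :
      Groupoid.inv (x ≫ eqToHom e ≫ y) =
        Groupoid.inv y ≫ eqToHom e.symm ≫ Groupoid.inv x := by
    subst e
    simp
  exact hext rfl rfl fun _ => heq_of_eq (inv_comp_eqToHom_comp _ _ _)

theorem square (w : T ⟶ Path (Path J)) :
    comp (w ≫ map (src J)) (w ≫ tgt (Path J)) (by
        rw [Category.assoc, Category.assoc, map_tgt]) =
      comp (w ≫ src (Path J)) (w ≫ map (tgt J)) (by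
        rw [Category.assoc, Category.assoc, map_src]) :=
  hext rfl rfl fun t => heq_of_eq ((congrArg (_ ≫ ·) (Category.id_comp _)).trans
    ((PathObj.Hom.w (F := 𝟭 J) (app w t)).trans (congrArg (_ ≫ ·) (Category.id_comp _).symm)))

section Product

variable {I X : Grpd.{u, u}}

/-- The first projection of the explicit product. -/
def prodFst (I X : Grpd.{u, u}) : Grpd.of (I × X) ⟶ I := CategoryTheory.Prod.fst I X

/-- The second projection of the explicit product. -/
def prodSnd (I X : Grpd.{u, u}) : Grpd.of (I × X) ⟶ X := CategoryTheory.Prod.snd I X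

/-- The comparison from the explicit product of groupoids. -/
noncomputable def fromProd (I X : Grpd.{u, u}) : Grpd.of (I × X) ⟶ I ⨯ X :=
  prod.lift (prodFst I X) (prodSnd I X)

/-- The comparison to the explicit product of groupoids. -/
noncomputable def toProd (I X : Grpd.{u, u}) : I ⨯ X ⟶ Grpd.of (I × X) :=
  Functor.prod' (prod.fst : I ⨯ X ⟶ I) (prod.snd : I ⨯ X ⟶ X)

theorem fromProd_fst (I X : Grpd.{u, u}) : fromProd I X ≫ prod.fst = prodFst I X :=
  prod.lift_fst _ _

theorem fromProd_snd (I X : Grpd.{u, u}) : fromProd I X ≫ prod.snd = prodSnd I X :=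
  prod.lift_snd _ _

theorem toProd_fromProd (I X : Grpd.{u, u}) : toProd I X ≫ fromProd I X = 𝟙 _ := by
  apply prod.hom_ext
  · rw [Category.assoc, fromProd_fst]
    rfl
  · rw [Category.assoc, fromProd_snd]
    rfl

/-- The arrow in an explicit product with given components. -/
def pairProd (w : T ⟶ Path I) (w' : T ⟶ Path X) : T ⟶ Path (Grpd.of (I × X)) :=
  mk (J := Grpd.of (I × X)) (Functor.prod' (w ≫ src I) (w' ≫ src X))
    (Functor.prod' (w ≫ tgt I) (w' ≫ tgt X)) (fun t => (app w t, app w' t))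
    fun f => Prod.ext (app_naturality w f) (app_naturality w' f)

theorem pairProd_eta (w : T ⟶ Path (Grpd.of (I × X))) :
    pairProd (w ≫ map (prodFst I X)) (w ≫ map (prodSnd I X)) = w := rfl

/-- The arrow in a product with given components. -/
noncomputable def pair (w : T ⟶ Path I) (w' : T ⟶ Path X) : T ⟶ Path (I ⨯ X) :=
  pairProd w w' ≫ map (fromProd I X)

theorem pair_fst (w : T ⟶ Path I) (w' : T ⟶ Path X) : pair w w' ≫ map prod.fst = w := by
  rw [pair, Category.assoc, ← map_comp, fromProd_fst]
  rfl

theorem pair_snd (w : T ⟶ Path I) (w' : T ⟶ Path X) : pair w w' ≫ map prod.snd = w' := by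
  rw [pair, Category.assoc, ← map_comp, fromProd_snd]
  rfl

theorem pair_eta (w : T ⟶ Path (I ⨯ X)) : pair (w ≫ map prod.fst) (w ≫ map prod.snd) = w := by
  have pairProd_eq : pairProd (w ≫ map prod.fst) (w ≫ map prod.snd) = w ≫ map (toProd I X) :=
    pairProd_eta (w ≫ map (toProd I X))
  rw [pair, pairProd_eq, Category.assoc, ← map_comp, toProd_fromProd, map_id, Category.comp_id]

theorem prod_ext {w w' : T ⟶ Path (I ⨯ X)} (h : w ≫ map prod.fst = w' ≫ map prod.fst)
    (h' : w ≫ map prod.snd = w' ≫ map prod.snd) : w = w' := by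
  rw [← pair_eta w, ← pair_eta w', h, h']

theorem pair_src (w : T ⟶ Path I) (w' : T ⟶ Path X) :
    pair w w' ≫ src _ = prod.lift (w ≫ src I) (w' ≫ src X) := by
  apply prod.hom_ext
  · rw [prod.lift_fst, Category.assoc, ← map_src, ← Category.assoc, pair_fst]
  · rw [prod.lift_snd, Category.assoc, ← map_src, ← Category.assoc, pair_snd]

theorem pair_tgt (w : T ⟶ Path I) (w' : T ⟶ Path X) :
    pair w w' ≫ tgt _ = prod.lift (w ≫ tgt I) (w' ≫ tgt X) := by
  apply prod.hom_ext
  · rw [prod.lift_fst, Category.assoc, ← map_tgt, ← Category.assoc, pair_fst]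
  · rw [prod.lift_snd, Category.assoc, ← map_tgt, ← Category.assoc, pair_snd]

end Product

end Path

section Mid

open ElemFib.Path

variable {A B A' B' T : Grpd.{u, u}}

/-- The arrow component of an object of the middle groupoid. -/
def isoPath (F : A ⟶ B) : grpdAWFS.mid F ⟶ Path B :=
  Path.mk (PathObj.baseFunctor F) (PathObj.ptFunctor F ⋙ F) (fun P => PathObj.iso P)
    fun f => PathObj.Hom.w f

/-- The point component of an object of the middle groupoid. -/
def ptMap (F : A ⟶ B) : grpdAWFS.mid F ⟶ A := PathObj.ptFunctor F

theorem isoPath_src (F : A ⟶ B) : isoPath F ≫ src B = grpdAWFS.rightMap F := rfl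
theorem isoPath_tgt (F : A ⟶ B) : isoPath F ≫ tgt B = ptMap F ≫ F := rfl

theorem mid_ext {F : A ⟶ B} {x y : T ⟶ grpdAWFS.mid F} (h : x ≫ isoPath F = y ≫ isoPath F)
    (h' : x ≫ ptMap F = y ≫ ptMap F) : x = y := by
  refine PathObj.functor_ext (X := T) (F := F) (congrArg (· ≫ src B) h) h' fun t => ?_
  have app_heq : HEq (app (x ≫ isoPath F) t) (app (y ≫ isoPath F) t) := by rw [h]
  rw [eqToHom_map]
  exact eq_of_heq ((comp_eqToHom_heq _ _).trans (app_heq.trans (eqToHom_comp_heq _ _).symm))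

/-- The functor into the middle groupoid with given components. -/
def pairMid (F : A ⟶ B) (w : T ⟶ Path B) (k : T ⟶ A) (h : w ≫ tgt B = k ≫ F) :
    T ⟶ grpdAWFS.mid F :=
  PathObj.lift (F := F) (w ≫ src B) k (fun t => app w t ≫ eqToHom (Functor.congr_obj h t))
    fun f => by
      rw [← Category.assoc, app_naturality, Functor.congr_hom h f]
      simp only [Category.assoc, eqToHom_trans, eqToHom_refl, Category.comp_id]
      rfl

theorem pairMid_isoPath (F : A ⟶ B) (w : T ⟶ Path B) (k : T ⟶ A) (h : w ≫ tgt B = k ≫ F) :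
    pairMid F w k h ≫ isoPath F = w :=
  Path.hext rfl h.symm fun _ => comp_eqToHom_heq _ _

theorem pairMid_ptMap (F : A ⟶ B) (w : T ⟶ Path B) (k : T ⟶ A) (h : w ≫ tgt B = k ≫ F) :
    pairMid F w k h ≫ ptMap F = k := rfl

theorem leftMap_isoPath (F : A ⟶ B) : grpdAWFS.leftMap F ≫ isoPath F = F ≫ refl B := rfl
theorem leftMap_ptMap (F : A ⟶ B) : grpdAWFS.leftMap F ≫ ptMap F = 𝟙 A := rfl

theorem midMap_isoPath {F : A ⟶ B} {F' : A' ⟶ B'} {l : A ⟶ A'} {f : B ⟶ B'}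
    (w : l ≫ F' = F ≫ f) :
    grpdAWFS.midMap l f w ≫ isoPath F' = isoPath F ≫ Path.map f :=
  pairMid_isoPath F' (isoPath F ≫ Path.map f) (ptMap F ≫ l) (congrArg (ptMap F ≫ ·) w.symm)

theorem mulMap_isoPath (F : A ⟶ B) : grpdAWFS.mulMap F ≫ isoPath F =
    comp (isoPath (grpdAWFS.rightMap F)) (ptMap (grpdAWFS.rightMap F) ≫ isoPath F) (by
      rw [isoPath_tgt, Category.assoc, isoPath_src]) :=
  hext rfl rfl fun _ => heq_of_eq (congrArg (_ ≫ ·) (Category.id_comp _).symm)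

theorem mulMap_ptMap (F : A ⟶ B) :
    grpdAWFS.mulMap F ≫ ptMap F = ptMap (grpdAWFS.rightMap F) ≫ ptMap F := rfl

/-- The canonical arrow from an object of the middle groupoid to an identity. -/
def contraction (F : A ⟶ B) : grpdAWFS.mid F ⟶ Path (grpdAWFS.mid F) :=
  grpdAWFS.comul (Arrow.mk F) ≫ isoPath (grpdAWFS.leftMap F)

theorem contraction_src (F : A ⟶ B) : contraction F ≫ src _ = 𝟙 _ := rfl
theorem contraction_tgt (F : A ⟶ B) : contraction F ≫ tgt _ = ptMap F ≫ grpdAWFS.leftMap F := rfl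
theorem contraction_map (F : A ⟶ B) :
    contraction F ≫ Path.map (grpdAWFS.rightMap F) = isoPath F := rfl

end Mid

end Paths

open AWFS AWFS.AlgOn

section Transport

variable {I J K T T' : Grpd.{u, u}}

/-- Transport of generalised elements of an algebra along generalised arrows of the base. -/
def transp (c : AlgOn grpdAWFS J) (w : T ⟶ Path J) (k : T ⟶ c.tot)
    (h : w ≫ Path.tgt J = k ≫ c.proj) : T ⟶ c.tot :=
  pairMid c.proj w k h ≫ c.str

variable {c : AlgOn grpdAWFS J}

theorem transp_def (w : T ⟶ Path J) (k : T ⟶ c.tot) (h : w ≫ Path.tgt J = k ≫ c.proj) :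
    transp c w k h = pairMid c.proj w k h ≫ c.str := rfl

theorem transp_congr {w w' : T ⟶ Path J} {k k' : T ⟶ c.tot} {h : w ≫ Path.tgt J = k ≫ c.proj}
    (e : w = w') (e' : k = k') : transp c w k h = transp c w' k' (by rw [← e, ← e', h]) := by
  subst e e'
  rfl

theorem transp_proj (w : T ⟶ Path J) (k : T ⟶ c.tot) (h : w ≫ Path.tgt J = k ≫ c.proj) :
    transp c w k h ≫ c.proj = w ≫ Path.src J := by
  rw [transp_def, Category.assoc, c.str_proj, ← isoPath_src, ← Category.assoc, pairMid_isoPath]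

theorem transp_refl (w : T ⟶ Path J) (k : T ⟶ c.tot) (h : w ≫ Path.tgt J = k ≫ c.proj)
    (hw : w = k ≫ c.proj ≫ Path.refl J) : transp c w k h = k := by
  have pairMid_eq : pairMid c.proj w k h = k ≫ grpdAWFS.leftMap c.proj := by
    refine mid_ext ?_ ?_
    · rw [pairMid_isoPath, Category.assoc, leftMap_isoPath, hw]
    · rw [pairMid_ptMap, Category.assoc, leftMap_ptMap, Category.comp_id]
  rw [transp_def, pairMid_eq, Category.assoc, c.lam_str, Category.comp_id]

theorem comp_transp (m : T' ⟶ T) (w : T ⟶ Path J) (k : T ⟶ c.tot)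
    (h : w ≫ Path.tgt J = k ≫ c.proj) : m ≫ transp c w k h =
      transp c (m ≫ w) (m ≫ k) (by rw [Category.assoc, Category.assoc, h]) := rfl

theorem transp_transp (w' w : T ⟶ Path J) (k : T ⟶ c.tot) (h : w ≫ Path.tgt J = k ≫ c.proj)
    (h' : w' ≫ Path.tgt J = transp c w k h ≫ c.proj) :
    transp c w' (transp c w k h) h' =
      transp c (Path.comp w' w (h'.trans (transp_proj w k h))) k (by
        rw [Path.comp_tgt, h]) := by
  have e : w' ≫ Path.tgt J = pairMid c.proj w k h ≫ grpdAWFS.rightMap c.proj :=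
    h'.trans (transp_proj w k h)
  let x := pairMid (grpdAWFS.rightMap c.proj) w' (pairMid c.proj w k h) e
  have mulMap_eq : x ≫ grpdAWFS.mulMap c.proj =
      pairMid c.proj (Path.comp w' w (h'.trans (transp_proj w k h))) k (by
        rw [Path.comp_tgt, h]) := by
    refine mid_ext ?_ ?_
    · rw [pairMid_isoPath, Category.assoc, mulMap_isoPath, Path.precomp_comp]
      exact Path.comp_congr (pairMid_isoPath _ _ _ _) (pairMid_isoPath _ w k h)
    · rfl
  have midMap_eq : x ≫ grpdAWFS.midMap c.str (𝟙 J) (c.str_proj.trans (Category.comp_id _).symm) =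
      pairMid c.proj w' (transp c w k h) h' := by
    refine mid_ext ?_ ?_
    · rw [pairMid_isoPath, Category.assoc, midMap_isoPath, Path.map_id, Category.comp_id]
      exact pairMid_isoPath _ _ _ _
    · rfl
  rw [transp_def, ← midMap_eq, transp_def, ← mulMap_eq, Category.assoc, Category.assoc, c.mul_str]

theorem isoPath_map_tgt {A A' : Grpd.{u, u}} {q : A ⟶ I} {q' : A' ⟶ J} {f : I ⟶ J} {l : A ⟶ A'}
    (w : l ≫ q' = q ≫ f) :
    (isoPath q ≫ Path.map f) ≫ Path.tgt J = (ptMap q ≫ l) ≫ q' := by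
  rw [Category.assoc, Category.assoc, Path.map_tgt, w, ← Category.assoc, isoPath_tgt,
    Category.assoc]

theorem midMap_str {a : AlgOn grpdAWFS I} {f : I ⟶ J} {l : a.tot ⟶ c.tot}
    (w : l ≫ c.proj = a.proj ≫ f) : grpdAWFS.midMap l f w ≫ c.str =
      transp c (isoPath a.proj ≫ Path.map f) (ptMap a.proj ≫ l)
        (isoPath_map_tgt w) := rfl

theorem isHom_of_transp {a : AlgOn grpdAWFS I} {f : I ⟶ J} {l : a.tot ⟶ c.tot}
    (w : l ≫ c.proj = a.proj ≫ f)
    (h : a.str ≫ l = transp c (isoPath a.proj ≫ Path.map f) (ptMap a.proj ≫ l)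
        (isoPath_map_tgt w)) : IsHom a c f l :=
  ⟨w, (midMap_str w).trans h.symm⟩

theorem str_comp_of_isHom {a : AlgOn grpdAWFS I} {f : I ⟶ J} {l : a.tot ⟶ c.tot}
    (hl : IsHom a c f l) :
    a.str ≫ l = transp c (isoPath a.proj ≫ Path.map f) (ptMap a.proj ≫ l)
        (isoPath_map_tgt hl.w) :=
  hl.map_str.symm.trans (midMap_str hl.w)

theorem transp_comp_of_isHom {a : AlgOn grpdAWFS I} {f : I ⟶ J} {l : a.tot ⟶ c.tot}
    (hl : IsHom a c f l) (w : T ⟶ Path I) (k : T ⟶ a.tot) (h : w ≫ Path.tgt I = k ≫ a.proj) :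
    transp a w k h ≫ l = transp c (w ≫ Path.map f) (k ≫ l) (by
      rw [Category.assoc, Category.assoc, hl.w, Path.map_tgt, ← Category.assoc, h,
        Category.assoc]) := by
  rw [transp_def, Category.assoc, str_comp_of_isHom hl, comp_transp]
  refine transp_congr ?_ rfl
  rw [← Category.assoc, pairMid_isoPath]

/-- The canonical arrow from a transport to the element transported. -/
def strPath (a : AlgOn grpdAWFS I) : grpdAWFS.mid a.proj ⟶ Path a.tot :=
  contraction a.proj ≫ Path.map a.str

theorem strPath_src (a : AlgOn grpdAWFS I) : strPath a ≫ Path.src _ = a.str := by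
  rw [strPath, Category.assoc, Path.map_src, ← Category.assoc, contraction_src, Category.id_comp]

theorem strPath_tgt (a : AlgOn grpdAWFS I) : strPath a ≫ Path.tgt _ = ptMap a.proj := by
  rw [strPath, Category.assoc, Path.map_tgt, ← Category.assoc, contraction_tgt, Category.assoc,
    a.lam_str, Category.comp_id]

theorem strPath_map (a : AlgOn grpdAWFS I) :
    strPath a ≫ Path.map a.proj = isoPath a.proj := by
  rw [strPath, Category.assoc, ← Path.map_comp, a.str_proj, contraction_map]

theorem isHom_transp {a : AlgOn grpdAWFS I} {f f' : I ⟶ J} {l : a.tot ⟶ c.tot}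
    (hl : IsHom a c f l) (w : a.tot ⟶ Path J) (ht : w ≫ Path.tgt J = l ≫ c.proj)
    (hs : w ≫ Path.src J = a.proj ≫ f') : IsHom a c f' (transp c w l ht) := by
  have hs' : transp c w l ht ≫ c.proj = a.proj ≫ f' := (transp_proj w l ht).trans hs
  refine isHom_of_transp hs' ?_
  have map_src_eq : (strPath a ≫ Path.map w) ≫ Path.map (Path.src J) =
      isoPath a.proj ≫ Path.map f' := by
    rw [Category.assoc, ← Path.map_comp, hs, Path.map_comp, ← Category.assoc, strPath_map]
  have map_tgt_eq : (strPath a ≫ Path.map w) ≫ Path.map (Path.tgt J) =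
      isoPath a.proj ≫ Path.map f := by
    rw [Category.assoc, ← Path.map_comp, ht, hl.w, Path.map_comp, ← Category.assoc, strPath_map]
  have src_eq : (strPath a ≫ Path.map w) ≫ Path.src _ = a.str ≫ w := by
    rw [Category.assoc, Path.map_src, ← Category.assoc, strPath_src]
  have tgt_eq : (strPath a ≫ Path.map w) ≫ Path.tgt _ = ptMap a.proj ≫ w := by
    rw [Category.assoc, Path.map_tgt, ← Category.assoc, strPath_tgt]
  have comm := Path.square (strPath a ≫ Path.map w)
  rw [Path.comp_congr map_src_eq tgt_eq, Path.comp_congr src_eq map_tgt_eq] at comm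
  rw [comp_transp, transp_congr rfl (str_comp_of_isHom hl), transp_transp,
    transp_congr rfl (comp_transp (ptMap a.proj) w l ht), transp_transp]
  exact transp_congr comm.symm rfl

end Transport

section TranspHom

variable {I J K : Grpd.{u, u}} {a : AlgOn grpdAWFS I} {c : AlgOn grpdAWFS J} {f' : I ⟶ J}

/-- Transport of an arrow of algebras along a path of the base, as an arrow of algebras. -/
def transpHom (φ : a.toFiber.1 ⟶ c.toFiber.1) (w : a.tot ⟶ Path J)
    (ht : w ≫ Path.tgt J = totMap φ ≫ c.proj) (hs : w ≫ Path.src J = a.proj ≫ f') :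
    a.toFiber.1 ⟶ c.toFiber.1 :=
  (isHom_transp (isHom_right_totMap φ) w ht hs).toHom

variable {φ : a.toFiber.1 ⟶ c.toFiber.1} {w : a.tot ⟶ Path J}
  {ht : w ≫ Path.tgt J = totMap φ ≫ c.proj} {hs : w ≫ Path.src J = a.proj ≫ f'}

instance isHomLift_transpHom : grpdAWFS.algFunctor.IsHomLift f' (transpHom φ w ht hs) :=
  IsHom.isHomLift _

theorem transpHom_congr {φ' : a.toFiber.1 ⟶ c.toFiber.1} {w' : a.tot ⟶ Path J}
    (hφ : φ = φ') (hw : w = w') :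
    transpHom φ w ht hs = transpHom φ' w' (hw ▸ hφ ▸ ht) (hw ▸ hs) := by
  subst hφ hw
  rfl

theorem transpHom_over_congr {f'' : I ⟶ J} (e : f' = f'') :
    transpHom φ w ht hs = transpHom φ w ht (e ▸ hs) := by
  subst e
  rfl

theorem transpHom_refl [grpdAWFS.algFunctor.IsHomLift f' φ]
    (hw : w = a.proj ≫ f' ≫ Path.refl J) : transpHom φ w ht hs = φ := by
  refine hom_ext f' (transp_refl w (totMap φ) ht ?_)
  rw [hw, ← Category.assoc (totMap φ), (isHom_totMap f' φ).w, Category.assoc]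

theorem comp_transpHom {b : AlgOn grpdAWFS K} (g : K ⟶ I) (ψ : b.toFiber.1 ⟶ a.toFiber.1)
    [grpdAWFS.algFunctor.IsHomLift g ψ] :
    ψ ≫ transpHom φ w ht hs = transpHom (f' := g ≫ f') (ψ ≫ φ) (totMap ψ ≫ w)
      (by rw [Category.assoc, ht, totMap_comp, Category.assoc])
      (by rw [Category.assoc, hs, ← Category.assoc, (isHom_totMap g ψ).w, Category.assoc]) :=
  hom_ext (g ≫ f') rfl

theorem transpHom_comp {b : AlgOn grpdAWFS K} (g : J ⟶ K) (ψ : c.toFiber.1 ⟶ b.toFiber.1)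
    [grpdAWFS.algFunctor.IsHomLift g ψ] :
    transpHom φ w ht hs ≫ ψ = transpHom (f' := f' ≫ g) (φ ≫ ψ) (w ≫ Path.map g)
      (by rw [Category.assoc, Path.map_tgt, ← Category.assoc, ht, totMap_comp, Category.assoc,
        Category.assoc, (isHom_totMap g ψ).w])
      (by rw [Category.assoc, Path.map_src, ← Category.assoc, hs, Category.assoc]) :=
  hom_ext (f' ≫ g) (transp_comp_of_isHom (isHom_totMap g ψ) w (totMap φ) ht)

theorem comp_transpHom_of_vertical {b : AlgOn grpdAWFS I} (ψ : b.toFiber.1 ⟶ a.toFiber.1)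
    [grpdAWFS.algFunctor.IsHomLift (𝟙 I) ψ] :
    ψ ≫ transpHom φ w ht hs = transpHom (ψ ≫ φ) (totMap ψ ≫ w)
      (by rw [Category.assoc, ht, totMap_comp, Category.assoc])
      (by rw [Category.assoc, hs, ← Category.assoc, (isHom_totMap (𝟙 I) ψ).w,
        Category.comp_id]) :=
  (comp_transpHom (𝟙 I) ψ).trans (transpHom_over_congr (Category.id_comp f'))

theorem transpHom_comp_of_vertical {b : AlgOn grpdAWFS J} (ψ : c.toFiber.1 ⟶ b.toFiber.1)
    [grpdAWFS.algFunctor.IsHomLift (𝟙 J) ψ] :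
    transpHom φ w ht hs ≫ ψ = transpHom (φ ≫ ψ) w
      (by rw [ht, totMap_comp, Category.assoc, (isHom_totMap (𝟙 J) ψ).w, Category.comp_id]) hs :=
  (transpHom_comp (𝟙 J) ψ).trans ((transpHom_over_congr (Category.comp_id f')).trans
    (transpHom_congr rfl (by rw [Path.map_id, Category.comp_id])))

theorem transpHom_transpHom {f'' : I ⟶ J} (w' : a.tot ⟶ Path J)
    (ht' : w' ≫ Path.tgt J = totMap (transpHom φ w ht hs) ≫ c.proj)
    (hs' : w' ≫ Path.src J = a.proj ≫ f'') :
    transpHom (transpHom φ w ht hs) w' ht' hs' =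
      transpHom φ (Path.comp w' w (ht'.trans (transp_proj w (totMap φ) ht)))
        (by rw [Path.comp_tgt, ht]) (by rw [Path.comp_src, hs']) :=
  hom_ext f'' (transp_transp w' w (totMap φ) ht ht')

end TranspHom

variable {I J I' J' : Grpd.{u, u}}

/-- A retraction of an arrow of algebras over `d`, lying over a retraction `t` of `d`, together with
a deformation of the identity onto its image: a path in the base, constant along `t` and on the
image, along which transport recovers the identity. This is what makes the arrow cocartesian. -/
structure DeformationRetract {a : AlgOn grpdAWFS I} {s : AlgOn grpdAWFS J} (d : I ⟶ J) (t : J ⟶ I)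
    (η : a.toFiber.1 ⟶ s.toFiber.1) where
  isHomLift : grpdAWFS.algFunctor.IsHomLift d η
  retr : s.toFiber.1 ⟶ a.toFiber.1
  isHomLift_retr : grpdAWFS.algFunctor.IsHomLift t retr
  comp_retr : η ≫ retr = 𝟙 _
  path : s.tot ⟶ Path J
  path_src : path ≫ Path.src J = s.proj ≫ 𝟙 J
  path_tgt : path ≫ Path.tgt J = totMap (retr ≫ η) ≫ s.proj
  path_map : path ≫ Path.map t = s.proj ≫ t ≫ Path.refl I
  comp_path : totMap η ≫ path = a.proj ≫ d ≫ Path.refl J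
  transpHom_eq : transpHom (retr ≫ η) path path_tgt path_src = 𝟙 _

namespace DeformationRetract

variable {a : AlgOn grpdAWFS I} {s : AlgOn grpdAWFS J} {d : I ⟶ J} {t : J ⟶ I}
  {η : a.toFiber.1 ⟶ s.toFiber.1}

theorem path_tgt_eq (D : DeformationRetract d t η) :
    D.path ≫ Path.tgt J = s.proj ≫ t ≫ d := by
  have := D.isHomLift
  have := D.isHomLift_retr
  rw [D.path_tgt, (isHom_totMap (t ≫ d) (D.retr ≫ η)).w]

theorem isCocartesian (D : DeformationRetract d t η) : grpdAWFS.algFunctor.IsCocartesian d η := by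
  have := D.isHomLift
  have := D.isHomLift_retr
  refine { universal_property := fun {b'} φ _ => ?_ }
  obtain ⟨c, hc⟩ := exists_eq_toFiber ⟨b', IsHomLift.codomain_eq _ d φ⟩
  obtain rfl : b' = c.toFiber.1 := congrArg Subtype.val hc
  have : grpdAWFS.algFunctor.IsHomLift (d ≫ 𝟙 J) φ := by rwa [Category.comp_id]
  let χ := transpHom (D.retr ≫ φ) D.path
    (by rw [D.path_tgt_eq, (isHom_totMap (t ≫ d) (D.retr ≫ φ)).w]) D.path_src
  refine ⟨χ, ⟨inferInstance, ?_⟩, fun χ' ⟨_, hχ'⟩ => ?_⟩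
  · refine (comp_transpHom d η).trans
      ((transpHom_congr ?_ D.comp_path).trans (transpHom_refl ?_))
    · rw [← Category.assoc, D.comp_retr, Category.id_comp]
    · rw [Category.comp_id]
  · calc χ' = transpHom (D.retr ≫ η) D.path D.path_tgt D.path_src ≫ χ' := by
          rw [D.transpHom_eq, Category.id_comp]
      _ = transpHom ((D.retr ≫ η) ≫ χ') D.path _ D.path_src := transpHom_comp_of_vertical χ'
      _ = χ := transpHom_congr (by rw [Category.assoc, hχ']) rfl

section Frobenius

variable {c p : AlgOn grpdAWFS I} {e q : AlgOn grpdAWFS J} {γ : c.toFiber.1 ⟶ e.toFiber.1}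
  {κ : p.toFiber.1 ⟶ q.toFiber.1} {π : p.toFiber ⟶ c.toFiber} {ρ : q.toFiber ⟶ e.toFiber}

theorem exists_retr_of_isStronglyCartesian (dt : d ≫ t = 𝟙 I)
    [grpdAWFS.algFunctor.IsStronglyCartesian d γ] [grpdAWFS.algFunctor.IsHomLift d κ]
    (w : κ ≫ ρ.1 = π.1 ≫ γ) {θ : q.tot ⟶ Path J} (θ_tgt : θ ≫ Path.tgt J = q.proj ≫ t ≫ d)
    (comp_θ : totMap κ ≫ θ = p.proj ≫ d ≫ Path.refl J)
    (inv_tgt : (θ ≫ Path.inv J) ≫ Path.tgt J = totMap ρ.1 ≫ e.proj) :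
    ∃ v : q.toFiber.1 ⟶ c.toFiber.1, grpdAWFS.algFunctor.IsHomLift t v ∧ κ ≫ v = π.1 ∧
      v ≫ γ = transpHom (f' := t ≫ d) ρ.1 (θ ≫ Path.inv J) inv_tgt
        (by rw [Category.assoc, Path.inv_src, θ_tgt]) := by
  let u := transpHom (f' := t ≫ d) ρ.1 (θ ≫ Path.inv J) inv_tgt
    (by rw [Category.assoc, Path.inv_src, θ_tgt])
  let v := Functor.IsStronglyCartesian.map grpdAWFS.algFunctor d γ (rfl : t ≫ d = t ≫ d) u
  have hvγ : v ≫ γ = u := Functor.IsStronglyCartesian.fac grpdAWFS.algFunctor d γ rfl u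
  have : grpdAWFS.algFunctor.IsHomLift t v :=
    Functor.IsStronglyCartesian.map_isHomLift grpdAWFS.algFunctor d γ rfl u
  have : grpdAWFS.algFunctor.IsHomLift (𝟙 I) (κ ≫ v) := dt ▸ inferInstance
  refine ⟨v, inferInstance, Functor.IsStronglyCartesian.ext grpdAWFS.algFunctor d γ (𝟙 I) ?_, hvγ⟩
  have : grpdAWFS.algFunctor.IsHomLift (d ≫ t ≫ d) (κ ≫ ρ.1) := by
    rw [← Category.assoc, dt, Category.id_comp]
    infer_instance
  calc (κ ≫ v) ≫ γ = κ ≫ u := by rw [Category.assoc, hvγ]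
    _ = transpHom (f' := d ≫ t ≫ d) (κ ≫ ρ.1) (totMap κ ≫ θ ≫ Path.inv J) _ _ := comp_transpHom d κ
    _ = κ ≫ ρ.1 := transpHom_refl (by
        rw [← Category.assoc, comp_θ, Category.assoc, Category.assoc, Path.refl_inv,
          ← Category.assoc d t, dt, Category.id_comp])
    _ = π.1 ≫ γ := w

theorem totMap_comp_path_src (D : DeformationRetract d t η) (σ : q.toFiber ⟶ s.toFiber) :
    (totMap σ.1 ≫ D.path) ≫ Path.src J = q.proj ≫ 𝟙 J := by
  rw [Category.assoc, D.path_src, Category.comp_id, (isHom_totMap (𝟙 J) σ.1).w]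

theorem totMap_comp_path_tgt (D : DeformationRetract d t η) (σ : q.toFiber ⟶ s.toFiber) :
    (totMap σ.1 ≫ D.path) ≫ Path.tgt J = q.proj ≫ t ≫ d := by
  rw [Category.assoc, D.path_tgt_eq, ← Category.assoc, (isHom_totMap (𝟙 J) σ.1).w,
    Category.comp_id]

theorem prod (dt : d ≫ t = 𝟙 I) (D : DeformationRetract d t η)
    [grpdAWFS.algFunctor.IsStronglyCartesian d γ] {π' : p.toFiber ⟶ a.toFiber}
    (hp : IsStrongProduct grpdAWFS.algFunctor π π') {ρ' : q.toFiber ⟶ s.toFiber}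
    (hq : IsStrongProduct grpdAWFS.algFunctor ρ ρ') [grpdAWFS.algFunctor.IsHomLift d κ]
    (w : κ ≫ ρ.1 = π.1 ≫ γ) (w' : κ ≫ ρ'.1 = π'.1 ≫ η) :
    Nonempty (DeformationRetract d t κ) := by
  have := D.isHomLift
  have := D.isHomLift_retr
  let θ : q.tot ⟶ Path J := totMap ρ'.1 ≫ D.path
  have θ_src : θ ≫ Path.src J = q.proj ≫ 𝟙 J := D.totMap_comp_path_src ρ'
  have θ_tgt : θ ≫ Path.tgt J = q.proj ≫ t ≫ d := D.totMap_comp_path_tgt ρ'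
  have comp_θ : totMap κ ≫ θ = p.proj ≫ d ≫ Path.refl J := by
    rw [← Category.assoc, ← totMap_comp, w', totMap_comp, Category.assoc, D.comp_path,
      ← Category.assoc, (isHom_totMap (𝟙 I) π'.1).w, Category.comp_id]
  obtain ⟨v, _, hκv, hvγ⟩ := exists_retr_of_isStronglyCartesian dt w θ_tgt comp_θ
    (by rw [Category.assoc, Path.inv_tgt, θ_src, (isHom_totMap (𝟙 J) ρ.1).w])
  obtain ⟨r, _, hrπ, hrπ'⟩ := hp.exists_lift t v (ρ'.1 ≫ D.retr)
  have : grpdAWFS.algFunctor.IsHomLift (𝟙 I) (κ ≫ r) := dt ▸ inferInstance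
  refine ⟨⟨inferInstance, r, inferInstance, hp.ext (𝟙 I) _ _ ?_ ?_, θ, θ_src,
    θ_tgt.trans (isHom_totMap (t ≫ d) (r ≫ κ)).w.symm, ?_, comp_θ, hq.ext (𝟙 J) _ _ ?_ ?_⟩⟩
  · rw [Category.assoc, hrπ, hκv, Category.id_comp]
  · rw [Category.assoc, hrπ', Category.id_comp, ← Category.assoc, w', Category.assoc, D.comp_retr,
      Category.comp_id]
  · rw [Category.assoc, D.path_map, ← Category.assoc, (isHom_totMap (𝟙 J) ρ'.1).w,
      Category.comp_id]
  · rw [transpHom_comp_of_vertical, Category.id_comp]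
    refine (transpHom_congr (by rw [Category.assoc, w, ← Category.assoc, hrπ, hvγ]) rfl).trans
      ((transpHom_transpHom _ _ _).trans (transpHom_refl ((Path.comp_inv θ).trans ?_)))
    rw [← Category.assoc, θ_src, Category.assoc]
  · have comp_ρ' : (r ≫ κ) ≫ ρ'.1 = ρ'.1 ≫ D.retr ≫ η := by
      rw [Category.assoc, w', ← Category.assoc, hrπ', Category.assoc]
    rw [transpHom_comp_of_vertical, Category.id_comp]
    exact (transpHom_congr comp_ρ' rfl).trans ((comp_transpHom_of_vertical ρ'.1).symm.trans
      ((congrArg (ρ'.1 ≫ ·) D.transpHom_eq).trans (Category.comp_id _)))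

end Frobenius

theorem reindex {d' : I' ⟶ J'} {t' : J' ⟶ I'} (dt' : d' ≫ t' = 𝟙 I') {f : I' ⟶ I} {g : J' ⟶ J}
    (sq : t' ≫ f = g ≫ t) {a' : AlgOn grpdAWFS I'} {s' : AlgOn grpdAWFS J'}
    (D : DeformationRetract d t η) {α : a'.toFiber.1 ⟶ a.toFiber.1}
    [grpdAWFS.algFunctor.IsStronglyCartesian f α] {σ : s'.toFiber.1 ⟶ s.toFiber.1}
    [grpdAWFS.algFunctor.IsStronglyCartesian g σ] {η' : a'.toFiber.1 ⟶ s'.toFiber.1}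
    [grpdAWFS.algFunctor.IsHomLift d' η'] (e : η' ≫ σ = α ≫ η) {θ : s'.tot ⟶ Path J'}
    (θ_src : θ ≫ Path.src J' = s'.proj ≫ 𝟙 J') (θ_tgt : θ ≫ Path.tgt J' = s'.proj ≫ t' ≫ d')
    (θ_map : θ ≫ Path.map t' = s'.proj ≫ t' ≫ Path.refl I')
    (comp_θ : totMap η' ≫ θ = a'.proj ≫ d' ≫ Path.refl J')
    (θ_map' : θ ≫ Path.map g = totMap σ ≫ D.path) : Nonempty (DeformationRetract d' t' η') := by
  have := D.isHomLift
  have := D.isHomLift_retr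
  let r := Functor.IsStronglyCartesian.map grpdAWFS.algFunctor f α sq.symm (σ ≫ D.retr)
  have hrα : r ≫ α = σ ≫ D.retr := Functor.IsStronglyCartesian.fac grpdAWFS.algFunctor f α _ _
  have : grpdAWFS.algFunctor.IsHomLift t' r :=
    Functor.IsStronglyCartesian.map_isHomLift grpdAWFS.algFunctor f α _ _
  have : grpdAWFS.algFunctor.IsHomLift (𝟙 I') (η' ≫ r) := dt' ▸ inferInstance
  refine ⟨⟨inferInstance, r, inferInstance,
    Functor.IsStronglyCartesian.ext grpdAWFS.algFunctor f α (𝟙 I') ?_, θ, θ_src,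
    θ_tgt.trans (isHom_totMap (t' ≫ d') (r ≫ η')).w.symm, θ_map, comp_θ,
    Functor.IsStronglyCartesian.ext grpdAWFS.algFunctor g σ (𝟙 J') ?_⟩⟩
  · rw [Category.assoc, hrα, ← Category.assoc, e, Category.assoc, D.comp_retr, Category.comp_id,
      Category.id_comp]
  · have comp_σ : (r ≫ η') ≫ σ = σ ≫ D.retr ≫ η := by
      rw [Category.assoc, e, ← Category.assoc, hrα, Category.assoc]
    calc _ = transpHom (f' := 𝟙 J' ≫ g) ((r ≫ η') ≫ σ) (θ ≫ Path.map g) _ _ := transpHom_comp g σ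
      _ = transpHom (f' := g ≫ 𝟙 J) (σ ≫ D.retr ≫ η) (totMap σ ≫ D.path) _ _ :=
        (transpHom_congr comp_σ θ_map').trans (transpHom_over_congr rfl)
      _ = σ ≫ transpHom (D.retr ≫ η) D.path D.path_tgt D.path_src := (comp_transpHom g σ).symm
      _ = 𝟙 _ ≫ σ := by rw [D.transpHom_eq, Category.comp_id, Category.id_comp]

end DeformationRetract

section PathAlgebra

variable {T X : Grpd.{u, u}}

theorem comp_comp_comp_comp (a b k c d : T ⟶ Path X) (hab : a ≫ Path.tgt X = b ≫ Path.src X)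
    (hbk : b ≫ Path.tgt X = k ≫ Path.src X) (hkc : k ≫ Path.tgt X = c ≫ Path.src X)
    (hcd : c ≫ Path.tgt X = d ≫ Path.src X) :
    Path.comp (Path.comp a (Path.comp (Path.comp b k hbk) c (by rw [Path.comp_tgt, hkc]))
      (by rw [Path.comp_src, Path.comp_src, hab])) d (by rw [Path.comp_tgt, Path.comp_tgt, hcd]) =
    Path.comp (Path.comp (Path.comp a b hab) k (by rw [Path.comp_tgt, hbk])) (Path.comp c d hcd)
      (by rw [Path.comp_tgt, Path.comp_src, hkc]) := by
  have assoc_outer := Path.comp_assoc (Path.comp (Path.comp a b hab) k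
    (by rw [Path.comp_tgt, hbk])) c d (by rw [Path.comp_tgt, hkc]) hcd
  refine (Path.comp_congr ?_ rfl).trans assoc_outer
  exact (Path.comp_assoc a (Path.comp b k hbk) c (by rw [Path.comp_src, hab])
    (by rw [Path.comp_tgt, hkc])).symm.trans
      (Path.comp_congr (Path.comp_assoc a b k hab hbk).symm rfl)

/-- The endpoints of an arrow. -/
noncomputable def pathProj (X : Grpd.{u, u}) : Path X ⟶ X ⨯ X := prod.lift (Path.src X) (Path.tgt X)

theorem pathProj_fst (X : Grpd.{u, u}) : pathProj X ≫ prod.fst = Path.src X := prod.lift_fst _ _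
theorem pathProj_snd (X : Grpd.{u, u}) : pathProj X ≫ prod.snd = Path.tgt X := prod.lift_snd _ _

variable {w : T ⟶ Path (X ⨯ X)} {k : T ⟶ Path X}

theorem map_fst_tgt (h : w ≫ Path.tgt (X ⨯ X) = k ≫ pathProj X) :
    (w ≫ Path.map prod.fst) ≫ Path.tgt X = k ≫ Path.src X := by
  rw [Category.assoc, Path.map_tgt, ← Category.assoc, h, Category.assoc, pathProj_fst]

theorem map_snd_inv_src (h : w ≫ Path.tgt (X ⨯ X) = k ≫ pathProj X) :
    (w ≫ Path.map prod.snd ≫ Path.inv X) ≫ Path.src X = k ≫ Path.tgt X := by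
  rw [Category.assoc, Category.assoc, Path.inv_src, Path.map_tgt, ← Category.assoc, h,
    Category.assoc, pathProj_snd]

/-- The composite of an arrow `k` with given paths into its two endpoints, the second one
reversed. -/
noncomputable def pathTransp (w : T ⟶ Path (X ⨯ X)) (k : T ⟶ Path X)
    (h : w ≫ Path.tgt (X ⨯ X) = k ≫ pathProj X) : T ⟶ Path X :=
  Path.comp (Path.comp (w ≫ Path.map prod.fst) k (map_fst_tgt h))
    (w ≫ Path.map prod.snd ≫ Path.inv X) (by rw [Path.comp_tgt, map_snd_inv_src h])

variable {h : w ≫ Path.tgt (X ⨯ X) = k ≫ pathProj X}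

theorem pathTransp_congr {w' : T ⟶ Path (X ⨯ X)} {k' : T ⟶ Path X} (hw : w = w') (hk : k = k') :
    pathTransp w k h = pathTransp w' k' (by rw [← hw, ← hk, h]) := by
  subst hw hk
  rfl

theorem comp_pathTransp {T' : Grpd.{u, u}} (m : T' ⟶ T) : m ≫ pathTransp w k h =
    pathTransp (m ≫ w) (m ≫ k) (by rw [Category.assoc, Category.assoc, h]) := rfl

theorem pathTransp_proj : pathTransp w k h ≫ pathProj X = w ≫ Path.src _ := by
  apply prod.hom_ext
  · rw [Category.assoc, pathProj_fst, pathTransp, Path.comp_src, Path.comp_src, Category.assoc,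
      Path.map_src, Category.assoc]
  · rw [Category.assoc, pathProj_snd, pathTransp, Path.comp_tgt, Category.assoc, Category.assoc,
      Path.inv_tgt, Path.map_src, Category.assoc]

theorem pathTransp_refl (hw : w = k ≫ pathProj X ≫ Path.refl _) : pathTransp w k h = k := by
  have map_fst : w ≫ Path.map prod.fst = k ≫ Path.src X ≫ Path.refl X := by
    rw [hw, Category.assoc, Category.assoc, Path.refl_map, ← Category.assoc (pathProj X),
      pathProj_fst]
  have map_snd_inv : w ≫ Path.map prod.snd ≫ Path.inv X = k ≫ Path.tgt X ≫ Path.refl X := by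
    rw [hw, Category.assoc, Category.assoc, ← Category.assoc (Path.refl _), Path.refl_map,
      Category.assoc, Path.refl_inv, ← Category.assoc (pathProj X), pathProj_snd]
  exact (Path.comp_congr (Path.refl_comp _ _ _ map_fst) rfl).trans
    (Path.comp_refl _ _ (map_snd_inv_src h).symm map_snd_inv)

theorem pathTransp_pathTransp {w' : T ⟶ Path (X ⨯ X)}
    (h' : w' ≫ Path.tgt (X ⨯ X) = pathTransp w k h ≫ pathProj X) :
    pathTransp w' (pathTransp w k h) h' =
      pathTransp (Path.comp w' w (h'.trans pathTransp_proj)) k (by rw [Path.comp_tgt, h]) := by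
  have hw : w' ≫ Path.tgt (X ⨯ X) = w ≫ Path.src _ := h'.trans pathTransp_proj
  have comp_map_snd_inv : Path.comp w' w hw ≫ Path.map prod.snd ≫ Path.inv X =
      Path.comp (w ≫ Path.map prod.snd ≫ Path.inv X) (w' ≫ Path.map prod.snd ≫ Path.inv X) (by
        simp only [Category.assoc, Path.inv_tgt, Path.inv_src, Path.map_tgt, Path.map_src]
        rw [← Category.assoc, ← Category.assoc, hw]) := by
    rw [← Category.assoc, Path.comp_map, Path.comp_comp_inv]
    rfl
  refine Eq.trans ?_ (Path.comp_congr (Path.comp_congr (Path.comp_map w' w hw prod.fst) rfl)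
    comp_map_snd_inv).symm
  exact comp_comp_comp_comp _ _ _ _ _ _ _ (map_snd_inv_src h).symm _

/-- The algebra of arrows of `X`, over their endpoints. -/
noncomputable def pathAlg (X : Grpd.{u, u}) : AlgOn grpdAWFS (X ⨯ X) where
  tot := Path X
  proj := pathProj X
  str := pathTransp (isoPath (pathProj X)) (ptMap (pathProj X)) (isoPath_tgt _)
  str_proj := by rw [pathTransp_proj, isoPath_src]
  lam_str := (comp_pathTransp (h := isoPath_tgt _) (grpdAWFS.leftMap (pathProj X))).trans
    (pathTransp_refl rfl)
  mul_str := by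
    have h : isoPath (grpdAWFS.rightMap (pathProj X)) ≫ Path.tgt (X ⨯ X) =
        (ptMap (grpdAWFS.rightMap (pathProj X)) ≫ pathTransp (isoPath (pathProj X))
          (ptMap (pathProj X)) (isoPath_tgt _)) ≫ pathProj X := by
      rw [Category.assoc, pathTransp_proj, isoPath_tgt, isoPath_src]
    rw [comp_pathTransp, comp_pathTransp, pathTransp_congr (mulMap_isoPath _) (mulMap_ptMap _)]
    refine (pathTransp_pathTransp (h := by rw [Category.assoc, Category.assoc, isoPath_tgt])
      (h.trans (congrArg (· ≫ pathProj X) (comp_pathTransp (h := isoPath_tgt _) _)))).symm.trans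
        (pathTransp_congr ?_ rfl).symm
    rw [midMap_isoPath, Path.map_id, Category.comp_id]

theorem transp_pathAlg : transp (pathAlg X) w k h = pathTransp w k h :=
  (comp_pathTransp (h := isoPath_tgt _) _).trans
    (pathTransp_congr (pairMid_isoPath (pathProj X) w k h) rfl)

theorem transp_pathAlg_refl {q : T ⟶ X}
    (hq : w ≫ Path.tgt (X ⨯ X) = (q ≫ Path.refl X) ≫ (pathAlg X).proj) :
    transp (pathAlg X) w (q ≫ Path.refl X) hq =
      Path.comp (w ≫ Path.map prod.fst) (w ≫ Path.map prod.snd ≫ Path.inv X)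
        ((map_fst_tgt hq).trans (map_snd_inv_src hq).symm) := by
  have map_fst_tgt_eq : (w ≫ Path.map prod.fst) ≫ Path.tgt X = q := by
    rw [map_fst_tgt hq, Category.assoc, Path.refl_src, Category.comp_id]
  refine transp_pathAlg.trans (Path.comp_congr (Path.comp_refl _ _ _ ?_) rfl)
  exact congrArg (· ≫ Path.refl X) map_fst_tgt_eq.symm

theorem isHom_refl {I : Grpd.{u, u}} (a : AlgOn grpdAWFS I) {q : I ⟶ X} {m : I ⟶ X ⨯ X}
    (hm : m ≫ prod.fst = q) (hm' : m ≫ prod.snd = q) :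
    IsHom a (pathAlg X) m ((a.proj ≫ q) ≫ Path.refl X) := by
  have w : ((a.proj ≫ q) ≫ Path.refl X) ≫ pathProj X = a.proj ≫ m := by
    apply prod.hom_ext
    · rw [Category.assoc, pathProj_fst, Category.assoc, Path.refl_src, Category.comp_id,
        Category.assoc, hm]
    · rw [Category.assoc, pathProj_snd, Category.assoc, Path.refl_tgt, Category.comp_id,
        Category.assoc, hm']
  have map_snd_inv : (isoPath a.proj ≫ Path.map m) ≫ Path.map prod.snd ≫ Path.inv X =
      (isoPath a.proj ≫ Path.map q) ≫ Path.inv X := by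
    rw [Category.assoc, ← Category.assoc (Path.map m), ← Path.map_comp, hm', Category.assoc]
  have map_fst : (isoPath a.proj ≫ Path.map m) ≫ Path.map prod.fst =
      isoPath a.proj ≫ Path.map q := by
    rw [Category.assoc, ← Path.map_comp, hm]
  refine isHom_of_transp w (Eq.symm ((transp_pathAlg_refl (q := ptMap a.proj ≫ a.proj ≫ q)
    (isoPath_map_tgt (q' := (pathAlg X).proj) w)).trans
    ((Path.comp_congr map_fst map_snd_inv).trans ((Path.comp_inv _).trans ?_))))
  exact congrArg (· ≫ q ≫ Path.refl X) ((isoPath_src a.proj).trans a.str_proj.symm)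

end PathAlgebra

section DiagPath

variable {T Y X : Grpd.{u, u}}

theorem paramDiag_fst (Y X : Grpd.{u, u}) : paramDiag Y X ≫ prod.fst = 𝟙 (Y ⨯ X) :=
  prod.lift_fst _ _

theorem paramDiag_snd (Y X : Grpd.{u, u}) : paramDiag Y X ≫ prod.snd = prod.snd :=
  prod.lift_snd _ _

/-- The path in `(Y ⨯ X) ⨯ X` which is `l` in the last coordinate and constant in the others. If
`l` ends at the second coordinate, it deforms the generalised element `q` into the diagonal. -/
noncomputable def diagPath (q : T ⟶ (Y ⨯ X) ⨯ X) (l : T ⟶ Path X) : T ⟶ Path ((Y ⨯ X) ⨯ X) :=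
  Path.pair (q ≫ prod.fst ≫ Path.refl _) l

variable {q : T ⟶ (Y ⨯ X) ⨯ X} {l : T ⟶ Path X}

theorem diagPath_map_fst : diagPath q l ≫ Path.map prod.fst = q ≫ prod.fst ≫ Path.refl _ :=
  Path.pair_fst _ _

theorem diagPath_map_snd : diagPath q l ≫ Path.map prod.snd = l := Path.pair_snd _ _

theorem diagPath_src (hl : l ≫ Path.src X = q ≫ prod.snd) : diagPath q l ≫ Path.src _ = q := by
  refine (Path.pair_src _ _).trans (prod.hom_ext ?_ ?_)
  · rw [prod.lift_fst, Category.assoc, Category.assoc, Path.refl_src, Category.comp_id]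
  · rw [prod.lift_snd, hl]

theorem diagPath_tgt (hl : l ≫ Path.tgt X = q ≫ prod.fst ≫ prod.snd) :
    diagPath q l ≫ Path.tgt _ = q ≫ prod.fst ≫ paramDiag Y X := by
  refine (Path.pair_tgt _ _).trans (prod.hom_ext ?_ ?_)
  · rw [prod.lift_fst, Category.assoc, Category.assoc, Path.refl_tgt, Category.comp_id,
      Category.assoc, Category.assoc, paramDiag_fst, Category.comp_id]
  · rw [prod.lift_snd, hl, Category.assoc, Category.assoc, paramDiag_snd]

theorem comp_diagPath {T' : Grpd.{u, u}} {m : T' ⟶ T} {p : T' ⟶ Y ⨯ X}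
    (hq : m ≫ q = p ≫ paramDiag Y X) (hl : m ≫ l = p ≫ prod.snd ≫ Path.refl X) :
    m ≫ diagPath q l = p ≫ paramDiag Y X ≫ Path.refl _ := by
  apply Path.prod_ext
  · rw [Category.assoc, diagPath_map_fst, ← Category.assoc, hq, Category.assoc, Category.assoc,
      Category.assoc, Path.refl_map]
  · rw [Category.assoc, diagPath_map_snd, hl, Category.assoc, Category.assoc, Path.refl_map,
      ← Category.assoc (paramDiag Y X), paramDiag_snd]

theorem DeformationRetract.changeParam {Z : Grpd.{u, u}} (f : Y ⟶ Z)
    {a : AlgOn grpdAWFS (Z ⨯ X)} {s : AlgOn grpdAWFS ((Z ⨯ X) ⨯ X)} {a' : AlgOn grpdAWFS (Y ⨯ X)}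
    {s' : AlgOn grpdAWFS ((Y ⨯ X) ⨯ X)} {η : a.toFiber.1 ⟶ s.toFiber.1}
    (D : DeformationRetract (paramDiag Z X) prod.fst η) {α : a'.toFiber.1 ⟶ a.toFiber.1}
    [grpdAWFS.algFunctor.IsStronglyCartesian (prod.map f (𝟙 X)) α]
    {σ : s'.toFiber.1 ⟶ s.toFiber.1}
    [grpdAWFS.algFunctor.IsStronglyCartesian (prod.map (prod.map f (𝟙 X)) (𝟙 X)) σ]
    {η' : a'.toFiber.1 ⟶ s'.toFiber.1} [grpdAWFS.algFunctor.IsHomLift (paramDiag Y X) η']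
    (e : η' ≫ σ = α ≫ η) : Nonempty (DeformationRetract (paramDiag Y X) prod.fst η') := by
  have := D.isHomLift
  let g : (Y ⨯ X) ⨯ X ⟶ (Z ⨯ X) ⨯ X := prod.map (prod.map f (𝟙 X)) (𝟙 X)
  have map_snd {U V : Grpd.{u, u}} (h : U ⟶ V) : prod.map h (𝟙 X) ≫ prod.snd = prod.snd := by
    rw [prod.map_snd, Category.comp_id]
  have hg : g ≫ prod.fst = prod.fst ≫ prod.map f (𝟙 X) := prod.map_fst _ _
  have hσ : totMap σ ≫ s.proj = s'.proj ≫ g := (isHom_totMap g σ).w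
  let l : s'.tot ⟶ Path X := totMap σ ≫ D.path ≫ Path.map prod.snd
  have l_src : l ≫ Path.src X = s'.proj ≫ prod.snd := by
    rw [Category.assoc, Category.assoc, Path.map_src, ← Category.assoc D.path, D.path_src,
      Category.comp_id, ← Category.assoc, hσ, Category.assoc, map_snd]
  have l_tgt : l ≫ Path.tgt X = s'.proj ≫ prod.fst ≫ prod.snd := by
    rw [Category.assoc, Category.assoc, Path.map_tgt, ← Category.assoc D.path, D.path_tgt_eq,
      Category.assoc, ← Category.assoc, hσ, Category.assoc, Category.assoc, paramDiag_snd,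
      ← Category.assoc g, hg, Category.assoc, map_snd]
  have comp_l : totMap η' ≫ l = a'.proj ≫ prod.snd ≫ Path.refl X := by
    rw [← Category.assoc, ← totMap_comp, e, totMap_comp, Category.assoc,
      ← Category.assoc (totMap η), D.comp_path, Category.assoc, Category.assoc, Path.refl_map,
      ← Category.assoc (paramDiag Z X), paramDiag_snd, ← Category.assoc,
      (isHom_totMap (prod.map f (𝟙 X)) α).w, Category.assoc, ← Category.assoc _ prod.snd, map_snd]
  refine D.reindex (paramDiag_fst Y X) hg.symm e
    ((diagPath_src l_src).trans (Category.comp_id _).symm) (diagPath_tgt l_tgt) diagPath_map_fst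
    (comp_diagPath (isHom_totMap _ η').w comp_l) (Path.prod_ext ?_ ?_)
  · rw [Category.assoc, ← Path.map_comp, hg, Path.map_comp, ← Category.assoc, diagPath_map_fst,
      Category.assoc, Category.assoc, Path.refl_map, Category.assoc, D.path_map,
      ← Category.assoc (totMap σ), hσ, Category.assoc, ← Category.assoc g, hg, Category.assoc]
  · rw [Category.assoc, ← Path.map_comp, map_snd, diagPath_map_snd, Category.assoc]

end DiagPath

section PathFamily

variable {Y X : Grpd.{u, u}}

/-- The last two coordinates, as the endpoints of a path from the last one to the one before. -/
noncomputable def endpoints (Y X : Grpd.{u, u}) : (Y ⨯ X) ⨯ X ⟶ X ⨯ X :=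
  prod.lift prod.snd (prod.fst ≫ prod.snd)

theorem endpoints_fst (Y X : Grpd.{u, u}) : endpoints Y X ≫ prod.fst = prod.snd :=
  prod.lift_fst _ _

theorem endpoints_snd (Y X : Grpd.{u, u}) : endpoints Y X ≫ prod.snd = prod.fst ≫ prod.snd :=
  prod.lift_snd _ _

theorem transp_diagPath {T : Grpd.{u, u}} {q : T ⟶ (Y ⨯ X) ⨯ X} {l : T ⟶ Path X}
    (hl : l ≫ Path.tgt X = q ≫ prod.fst ≫ prod.snd)
    (hq : (diagPath q l ≫ Path.map (endpoints Y X)) ≫ Path.tgt (X ⨯ X) =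
      ((q ≫ prod.fst ≫ prod.snd) ≫ Path.refl X) ≫ (pathAlg X).proj) :
    transp (pathAlg X) (diagPath q l ≫ Path.map (endpoints Y X))
      ((q ≫ prod.fst ≫ prod.snd) ≫ Path.refl X) hq = l := by
  have map_fst : (diagPath q l ≫ Path.map (endpoints Y X)) ≫ Path.map prod.fst = l := by
    rw [Category.assoc, ← Path.map_comp, endpoints_fst, diagPath_map_snd]
  have map_snd_inv : (diagPath q l ≫ Path.map (endpoints Y X)) ≫
      Path.map prod.snd ≫ Path.inv X = l ≫ Path.tgt X ≫ Path.refl X := by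
    rw [Category.assoc, ← Category.assoc (Path.map _), ← Path.map_comp, endpoints_snd,
      Path.map_comp, Category.assoc, ← Category.assoc, diagPath_map_fst, Category.assoc,
      Category.assoc, ← Category.assoc (Path.refl _), Path.refl_map, Category.assoc,
      Path.refl_inv, ← Category.assoc l, hl, Category.assoc, Category.assoc]
  refine (transp_pathAlg_refl hq).trans ((Path.comp_congr map_fst map_snd_inv).trans
    (Path.comp_refl _ _ ?_ rfl))
  rw [Category.assoc, Category.assoc, Path.refl_src, Category.comp_id]

/-- The universal property of the algebra of pairs of an element of `a` over `(y, x)` and a path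
`x' ⟶ x`, with its two projections. It is the value at `a` of the left adjoint to reindexing along
the parametrised diagonal. -/
structure IsPathFamily {a : AlgOn grpdAWFS (Y ⨯ X)} {s : AlgOn grpdAWFS ((Y ⨯ X) ⨯ X)}
    (r : s.toFiber.1 ⟶ a.toFiber.1) (ρ : s.toFiber.1 ⟶ (pathAlg X).toFiber.1) : Prop where
  isHomLift_elt : grpdAWFS.algFunctor.IsHomLift (prod.fst : (Y ⨯ X) ⨯ X ⟶ Y ⨯ X) r
  isHomLift_path : grpdAWFS.algFunctor.IsHomLift (endpoints Y X) ρ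
  exists_lift : ∀ {K : Grpd.{u, u}} (k : K ⟶ (Y ⨯ X) ⨯ X) {z : AlgOn grpdAWFS K}
    (φ : z.toFiber.1 ⟶ a.toFiber.1) (ψ : z.toFiber.1 ⟶ (pathAlg X).toFiber.1)
    [grpdAWFS.algFunctor.IsHomLift (k ≫ prod.fst) φ]
    [grpdAWFS.algFunctor.IsHomLift (k ≫ endpoints Y X) ψ],
    ∃ χ : z.toFiber.1 ⟶ s.toFiber.1,
      grpdAWFS.algFunctor.IsHomLift k χ ∧ χ ≫ r = φ ∧ χ ≫ ρ = ψ
  hom_ext : ∀ {K : Grpd.{u, u}} (k : K ⟶ (Y ⨯ X) ⨯ X) {z : AlgOn grpdAWFS K}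
    {χ χ' : z.toFiber.1 ⟶ s.toFiber.1} [grpdAWFS.algFunctor.IsHomLift k χ]
    [grpdAWFS.algFunctor.IsHomLift k χ'], χ ≫ r = χ' ≫ r → χ ≫ ρ = χ' ≫ ρ → χ = χ'

instance hasFiniteWidePullbacks_grpd : HasFiniteWidePullbacks Grpd.{u, u} :=
  have : HasLimits Grpd.{u, u} := hasLimits_of_reflective Grpd.forgetToCat
  inferInstance

theorem exists_isPathFamily (a : AlgOn grpdAWFS (Y ⨯ X)) :
    ∃ (s : AlgOn grpdAWFS ((Y ⨯ X) ⨯ X)) (r : s.toFiber.1 ⟶ a.toFiber.1)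
      (ρ : s.toFiber.1 ⟶ (pathAlg X).toFiber.1), IsPathFamily r ρ := by
  let J : Bool → Grpd.{u, u} := fun i => bif i then Y ⨯ X else X ⨯ X
  let f : ∀ i, (Y ⨯ X) ⨯ X ⟶ J i := fun | true => prod.fst | false => endpoints Y X
  let A : ∀ i, grpdAWFS.algFunctor.Fiber (J i) := fun
    | true => a.toFiber
    | false => (pathAlg X).toFiber
  obtain ⟨S, γ, hγ⟩ := grpdAWFS.exists_isCartesianCone f A
  obtain ⟨s, rfl⟩ := exists_eq_toFiber S
  refine ⟨s, γ true, γ false, hγ.isHomLift true, hγ.isHomLift false, fun k z φ ψ _ _ => ?_,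
    fun k z χ χ' _ _ hr hρ => hγ.hom_ext k (Z := z.toFiber) (Bool.forall_bool.2 ⟨hρ, hr⟩)⟩
  obtain ⟨χ, ⟨hχ, hχγ⟩, -⟩ := hγ.existsUnique_lift k (Z := z.toFiber)
    (fun | true => φ | false => ψ) (Bool.forall_bool.2 ⟨‹_›, ‹_›⟩)
  exact ⟨χ, hχ, hχγ true, hχγ false⟩

/-- The paths in `X` which an arrow into `pathAlg X` assigns to the elements of its domain. -/
noncomputable def pathMap {K : Grpd.{u, u}} {s : AlgOn grpdAWFS K}
    (ρ : s.toFiber.1 ⟶ (pathAlg X).toFiber.1) : s.tot ⟶ Path X := totMap ρ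

namespace IsPathFamily

variable {a : AlgOn grpdAWFS (Y ⨯ X)} {s : AlgOn grpdAWFS ((Y ⨯ X) ⨯ X)}
  {r : s.toFiber.1 ⟶ a.toFiber.1} {ρ : s.toFiber.1 ⟶ (pathAlg X).toFiber.1}

theorem pathMap_proj (H : IsPathFamily r ρ) : pathMap ρ ≫ pathProj X = s.proj ≫ endpoints Y X :=
  have := H.isHomLift_path
  (isHom_totMap (endpoints Y X) ρ).w

theorem pathMap_src (H : IsPathFamily r ρ) : pathMap ρ ≫ Path.src X = s.proj ≫ prod.snd := by
  rw [← pathProj_fst, ← Category.assoc, H.pathMap_proj, Category.assoc, endpoints_fst]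

theorem pathMap_tgt (H : IsPathFamily r ρ) :
    pathMap ρ ≫ Path.tgt X = s.proj ≫ prod.fst ≫ prod.snd := by
  rw [← pathProj_snd, ← Category.assoc, H.pathMap_proj, Category.assoc, endpoints_snd]

theorem exists_section (H : IsPathFamily r ρ) : ∃ η : a.toFiber.1 ⟶ s.toFiber.1,
    grpdAWFS.algFunctor.IsHomLift (paramDiag Y X) η ∧ η ≫ r = 𝟙 _ ∧
      totMap (η ≫ ρ) = (a.proj ≫ prod.snd) ≫ Path.refl X := by
  have h := isHom_refl a (m := paramDiag Y X ≫ endpoints Y X) (q := prod.snd)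
    (by rw [Category.assoc, endpoints_fst, paramDiag_snd])
    (by rw [Category.assoc, endpoints_snd, ← Category.assoc, paramDiag_fst, Category.id_comp])
  have := h.isHomLift
  have : grpdAWFS.algFunctor.IsHomLift (paramDiag Y X ≫ prod.fst) (𝟙 a.toFiber.1) :=
    paramDiag_fst Y X ▸ inferInstance
  obtain ⟨η, hη, hηr, hηρ⟩ := H.exists_lift (paramDiag Y X) (𝟙 _) h.toHom
  exact ⟨η, hη, hηr, congrArg totMap hηρ⟩

theorem exists_deformationRetract (H : IsPathFamily r ρ) : ∃ η : a.toFiber.1 ⟶ s.toFiber.1,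
    Nonempty (DeformationRetract (paramDiag Y X) prod.fst η) := by
  have := H.isHomLift_elt
  have := H.isHomLift_path
  obtain ⟨η, _, hηr, hηρ⟩ := H.exists_section
  have totMap_retr_path : totMap ((r ≫ η) ≫ ρ) =
      (s.proj ≫ prod.fst ≫ prod.snd) ≫ Path.refl X := by
    rw [Category.assoc, totMap_comp, hηρ]
    exact congrArg (· ≫ prod.snd ≫ Path.refl X) (isHom_totMap prod.fst r).w
  refine ⟨η, ⟨⟨inferInstance, r, inferInstance, hηr, diagPath s.proj (pathMap ρ),
    (diagPath_src H.pathMap_src).trans (Category.comp_id _).symm,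
    (diagPath_tgt H.pathMap_tgt).trans (isHom_totMap (prod.fst ≫ paramDiag Y X) (r ≫ η)).w.symm,
    diagPath_map_fst, comp_diagPath (isHom_totMap _ η).w (hηρ.trans (Category.assoc _ _ _)),
    H.hom_ext (𝟙 _) ?_ ?_⟩⟩⟩
  · have : grpdAWFS.algFunctor.IsHomLift (𝟙 _ ≫ prod.fst) r := H.isHomLift_elt
    refine (transpHom_comp prod.fst r).trans ((transpHom_congr ?_ diagPath_map_fst).trans
      ((transpHom_refl rfl).trans (Category.id_comp r).symm))
    rw [Category.assoc, hηr, Category.comp_id]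
  · rw [transpHom_comp (endpoints Y X)]
    refine AlgOn.hom_ext (𝟙 _ ≫ endpoints Y X) ?_
    refine (transp_congr rfl totMap_retr_path).trans (transp_diagPath H.pathMap_tgt ?_)
    rw [← totMap_retr_path, Category.assoc, Path.map_tgt, ← Category.assoc,
      diagPath_tgt H.pathMap_tgt]
    exact (isHom_totMap ((prod.fst ≫ paramDiag Y X) ≫ endpoints Y X) _).w.symm

end IsPathFamily

end PathFamily

/-- Arrows over a parametrised diagonal that have a deformation retraction, as a class of arrows
between objects of the fibres. -/
inductive HasDeformationRetract {Y X : Grpd.{u, u}} : ∀ {A : grpdAWFS.algFunctor.Fiber (Y ⨯ X)}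
    {S : grpdAWFS.algFunctor.Fiber ((Y ⨯ X) ⨯ X)}, (A.1 ⟶ S.1) → Prop
  | mk {a : AlgOn grpdAWFS (Y ⨯ X)} {s : AlgOn grpdAWFS ((Y ⨯ X) ⨯ X)}
    {η : a.toFiber.1 ⟶ s.toFiber.1} (D : DeformationRetract (paramDiag Y X) prod.fst η) :
    HasDeformationRetract (A := a.toFiber) (S := s.toFiber) η

theorem isDiagonalClass_hasDeformationRetract :
    IsDiagonalClass grpdAWFS.{u}.algFunctor HasDeformationRetract where
  isCocartesian := fun ⟨D⟩ => D.isCocartesian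
  exists_arrow A := by
    obtain ⟨a, rfl⟩ := exists_eq_toFiber A
    obtain ⟨s, r, ρ, H⟩ := exists_isPathFamily a
    obtain ⟨η, ⟨D⟩⟩ := H.exists_deformationRetract
    exact ⟨s.toFiber, η, .mk D⟩
  frobenius := by
    rintro Y X A C' P S C Q η ⟨D⟩ γ _ π π' hP ρ ρ' hQ κ _ w w'
    obtain ⟨c', rfl⟩ := exists_eq_toFiber C'
    obtain ⟨c, rfl⟩ := exists_eq_toFiber C
    obtain ⟨p, rfl⟩ := exists_eq_toFiber P
    obtain ⟨q, rfl⟩ := exists_eq_toFiber Q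
    obtain ⟨D'⟩ := D.prod (paramDiag_fst Y X) hP hQ w w'
    exact .mk D'
  beckChevalley := by
    rintro Y Z f X A S A' S' η ⟨D⟩ α _ σ _ η' _ e
    obtain ⟨a', rfl⟩ := exists_eq_toFiber A'
    obtain ⟨s', rfl⟩ := exists_eq_toFiber S'
    obtain ⟨D'⟩ := D.changeParam f e
    exact .mk D'

theorem isElementary_algFunctor : IsElementary grpdAWFS.{u}.algFunctor :=
  isDiagonalClass_hasDeformationRetract.isElementary
    grpdAWFS.hasStrongProducts_algFunctor

section EqToHom

variable {C : Type*} [Category C]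

theorem eq_conj_eqToHom {a b a' b' : C} (p : a = a') (q : b = b') {g : a ⟶ b} {f : a' ⟶ b'}
    (h : g ≫ eqToHom q = eqToHom p ≫ f) : g = eqToHom p ≫ f ≫ eqToHom q.symm := by
  subst p q
  simpa using h

theorem over_mk_congr {a b b' : C} (e : b = b') {f : b ⟶ a} {f' : b' ⟶ a}
    (h : f = eqToHom e ≫ f') : Over.mk f = Over.mk f' := by
  subst e
  rw [h, eqToHom_refl, Category.id_comp]

theorem over_hom_eq {a : C} {x y : Over a} (e : x = y) :
    x.hom = eqToHom (congrArg (fun z : Over a => z.left) e) ≫ y.hom := by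
  subst e
  exact (Category.id_comp _).symm

end EqToHom

section Cleavages

variable {A B A' B' : Type u} [Groupoid.{u} A] [Groupoid.{u} B] [Groupoid.{u} A'] [Groupoid.{u} B']
  {F : A ⥤ B} {F' : A' ⥤ B'}

namespace PathObj

/-- The canonical arrow `(a, x) ⟶ (a, 𝟙)`. -/
def toLam (P : PathObj F) : P ⟶ (lam F).obj P.pt :=
  ⟨P.iso, 𝟙 P.pt, congrArg (fun t => P.iso ≫ t) (F.map_id P.pt).symm⟩

theorem toLam_pt (P : PathObj F) : (toLam P).pt = 𝟙 P.pt := rfl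

theorem toLam_naturality {P Q : PathObj F} (f : P ⟶ Q) :
    f ≫ toLam Q = toLam P ≫ (lam F).map f.pt :=
  hom_ext f.w ((Category.comp_id f.pt).trans (Category.id_comp f.pt).symm)

theorem map_obj_lam {H : A ⥤ A'} {K : B ⥤ B'} (h : H ⋙ F' = F ⋙ K) (a : A) :
    (PathObj.map h).obj ((lam F).obj a) = (lam F').obj (H.obj a) :=
  (Functor.congr_obj (lam_nat h) a).symm

theorem map_toLam {H : A ⥤ A'} {K : B ⥤ B'} (h : H ⋙ F' = F ⋙ K) (P : PathObj F) :
    (PathObj.map h).map (toLam P) ≫ eqToHom (map_obj_lam h P.pt) =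
      toLam ((PathObj.map h).obj P) := by
  apply hom_ext
  · rw [comp_base, eqToHom_base]
    rfl
  · rw [comp_pt, eqToHom_pt]
    exact (Category.comp_id _).trans (H.map_id _)

theorem map_congr {H : A ⥤ A'} {K K' : B ⥤ B'} (e : K = K') (h : H ⋙ F' = F ⋙ K) :
    PathObj.map h = PathObj.map (h.trans (congrArg (F ⋙ ·) e)) := by
  subst e
  rfl

end PathObj

open PathObj

section LiftHom

variable {s : PathObj F ⥤ A} {s' : PathObj F' ⥤ A'}

/-- The arrow `s (a, x) ⟶ a` of a unital action `s`. -/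
def liftHom (hl : lam F ⋙ s = 𝟭 A) (P : PathObj F) : s.obj P ⟶ P.pt :=
  s.map (toLam P) ≫ eqToHom (Functor.congr_obj hl P.pt)

theorem liftHom_lam (hl : lam F ⋙ s = 𝟭 A) (a : A) :
    liftHom hl ((lam F).obj a) = eqToHom (Functor.congr_obj hl a) := by
  have map_toLam_lam : s.map (toLam ((lam F).obj a)) = 𝟙 _ := s.map_id _
  exact (congrArg (· ≫ eqToHom _) map_toLam_lam).trans (Category.id_comp _)

theorem liftHom_naturality (hl : lam F ⋙ s = 𝟭 A) {P Q : PathObj F} (f : P ⟶ Q) :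
    s.map f ≫ liftHom hl Q = liftHom hl P ≫ f.pt := by
  have map_lam_map := Functor.congr_hom hl f.pt
  rw [Functor.comp_map] at map_lam_map
  rw [liftHom, liftHom, ← Category.assoc, ← s.map_comp, toLam_naturality, s.map_comp, map_lam_map]
  simp

theorem map_liftHom (hl : lam F ⋙ s = 𝟭 A) (hp : s ⋙ F = baseFunctor F) (P : PathObj F) :
    F.map (liftHom hl P) = eqToHom (Functor.congr_obj hp P) ≫ P.iso := by
  have map_map_toLam := Functor.congr_hom hp (toLam P)
  rw [Functor.comp_map] at map_map_toLam
  rw [liftHom, F.map_comp, map_map_toLam, eqToHom_map, Category.assoc, Category.assoc,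
    eqToHom_trans]
  exact congrArg (eqToHom _ ≫ ·) (Category.comp_id _)

theorem map_liftHom_of_square (hl : lam F ⋙ s = 𝟭 A) (hl' : lam F' ⋙ s' = 𝟭 A') {H : A ⥤ A'}
    {K : B ⥤ B'} (h : H ⋙ F' = F ⋙ K) (sq : PathObj.map h ⋙ s' = s ⋙ H) (P : PathObj F) :
    H.map (liftHom hl P) =
      eqToHom (Functor.congr_obj sq P).symm ≫ liftHom hl' ((PathObj.map h).obj P) := by
  have map_map_toLam := Functor.congr_hom sq.symm (toLam P)
  rw [Functor.comp_map, Functor.comp_map] at map_map_toLam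
  have map_toLam_map := congrArg s'.map (map_toLam h P)
  rw [s'.map_comp, eqToHom_map] at map_toLam_map
  have liftHom_map : liftHom hl' ((PathObj.map h).obj P) = _ :=
    congrArg (· ≫ eqToHom (Functor.congr_obj hl' (H.obj P.pt))) map_toLam_map.symm
  rw [liftHom_map, liftHom, H.map_comp, map_map_toLam, eqToHom_map]
  simp only [Category.assoc, eqToHom_trans]
  rfl

theorem square_of_natural {ℓ : ∀ P, s.obj P ⟶ P.pt} {ℓ' : ∀ P, s'.obj P ⟶ P.pt}
    (hℓ : ∀ {P Q : PathObj F} (f : P ⟶ Q), s.map f ≫ ℓ Q = ℓ P ≫ f.pt)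
    (hℓ' : ∀ {P Q : PathObj F'} (f : P ⟶ Q), s'.map f ≫ ℓ' Q = ℓ' P ≫ f.pt) {H : A ⥤ A'}
    {K : B ⥤ B'} (h : H ⋙ F' = F ⋙ K)
    (hobj : ∀ P, H.obj (s.obj P) = s'.obj ((PathObj.map h).obj P))
    (hmap : ∀ P, H.map (ℓ P) = eqToHom (hobj P) ≫ ℓ' ((PathObj.map h).obj P)) :
    PathObj.map h ⋙ s' = s ⋙ H := by
  refine CategoryTheory.Functor.ext (fun P => (hobj P).symm) fun P Q f => ?_
  have naturality := congrArg H.map (hℓ f)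
  rw [H.map_comp, H.map_comp, hmap, hmap] at naturality
  have naturality' : s'.map ((PathObj.map h).map f) ≫ ℓ' ((PathObj.map h).obj Q) =
    ℓ' ((PathObj.map h).obj P) ≫ H.map f.pt := hℓ' ((PathObj.map h).map f)
  have map_map_comp : H.map (s.map f) ≫ eqToHom (hobj Q) =
      eqToHom (hobj P) ≫ s'.map ((PathObj.map h).map f) := by
    rw [← cancel_mono (ℓ' ((PathObj.map h).obj Q)), Category.assoc, Category.assoc]
    exact naturality.trans
      ((Category.assoc _ _ _).trans (congrArg (eqToHom (hobj P) ≫ ·) naturality'.symm))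
  change s'.map ((PathObj.map h).map f) = eqToHom _ ≫ H.map (s.map f) ≫ eqToHom _
  rw [map_map_comp]
  simp

theorem liftHom_mul_pt (Q : PathObj (baseFunctor F)) :
    (liftHom (lam_mul' (F := F)) Q).pt = 𝟙 Q.pt.pt := by
  rw [liftHom, comp_pt, eqToHom_pt]
  exact Category.comp_id _

end LiftHom

namespace SplitCleavage

/-- The split cleavage of an algebra. -/
def ofAlg (s : PathObj F ⥤ A) (hp : s ⋙ F = baseFunctor F) (hl : lam F ⋙ s = 𝟭 A)
    (hm : mul F ⋙ s = PathObj.map (H := s) (K := 𝟭 B) hp ⋙ s) : SplitCleavage F where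
  lift a _ x := Over.mk (liftHom hl ⟨_, a, x⟩)
  obj_lift a _ x := Functor.congr_obj hp ⟨_, a, x⟩
  map_lift a _ x := map_liftHom hl hp ⟨_, a, x⟩
  lift_id a := over_mk_congr (Functor.congr_obj hl a)
    ((liftHom_lam hl a).trans (Category.comp_id _).symm)
  lift_comp a b c y x := by
    let Q : PathObj (baseFunctor F) := ⟨c, ⟨b, a, x⟩, y⟩
    have map_liftHom_mul := map_liftHom_of_square lam_mul' hl (H := s) (K := 𝟭 B) hp hm.symm Q
    have naturality := liftHom_naturality hl (liftHom (lam_mul' (F := F)) Q)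
    rw [liftHom_mul_pt] at naturality
    refine over_mk_congr (Functor.congr_obj hm Q) ?_
    refine ((Category.comp_id _).symm.trans naturality.symm).trans ?_
    exact (congrArg (· ≫ liftHom hl Q.pt) map_liftHom_mul).trans (Category.assoc _ _ _)

theorem ext_lift {c c' : SplitCleavage F}
    (h : ∀ (a : A) (b : B) (x : b ⟶ F.obj a), c.lift a x = c'.lift a x) : c = c' := by
  obtain ⟨lift, _, _, _, _⟩ := c
  obtain ⟨lift', _, _, _, _⟩ := c'
  obtain rfl : @lift = @lift' := by
    funext a b x
    exact h a b x
  rfl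

variable (c : SplitCleavage F)

/-- The action attached to a split cleavage. -/
def act : PathObj F ⥤ A where
  obj P := (c.lift P.pt P.iso).left
  map {P Q} f := (c.lift P.pt P.iso).hom ≫ f.pt ≫ Groupoid.inv (c.lift Q.pt Q.iso).hom
  map_id P := by
    rw [id_pt, Category.id_comp, Groupoid.comp_inv]
  map_comp f g := by
    rw [comp_pt]
    simp

/-- The arrow from the action to the object acted upon. -/
def actHom (P : PathObj F) : c.act.obj P ⟶ P.pt := (c.lift P.pt P.iso).hom

theorem act_map {P Q : PathObj F} (f : P ⟶ Q) :
    c.act.map f = c.actHom P ≫ f.pt ≫ Groupoid.inv (c.actHom Q) := rfl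

theorem act_naturality {P Q : PathObj F} (f : P ⟶ Q) :
    c.act.map f ≫ c.actHom Q = c.actHom P ≫ f.pt := by
  rw [act_map, Category.assoc, Category.assoc, Groupoid.inv_comp, Category.comp_id]

theorem act_obj_proj (P : PathObj F) : F.obj (c.act.obj P) = P.base :=
  c.obj_lift P.pt P.iso

theorem act_obj_lam (a : A) : c.act.obj ((lam F).obj a) = a :=
  congrArg (fun z : Over a => z.left) (c.lift_id a)

theorem act_obj_mul (Q : PathObj (baseFunctor F)) : c.act.obj ((mul F).obj Q) =
    c.act.obj ⟨Q.base, c.act.obj Q.pt, Q.iso ≫ eqToHom (c.act_obj_proj Q.pt).symm⟩ :=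
  congrArg (fun z : Over Q.pt.pt => z.left) (c.lift_comp Q.pt.pt Q.iso Q.pt.iso)

theorem map_actHom (P : PathObj F) :
    F.map (c.actHom P) = eqToHom (c.act_obj_proj P) ≫ P.iso := c.map_lift P.pt P.iso

theorem act_proj : c.act ⋙ F = baseFunctor F := by
  refine CategoryTheory.Functor.ext c.act_obj_proj fun P Q f => ?_
  have map_naturality := congrArg F.map (c.act_naturality f)
  rw [F.map_comp, F.map_comp, map_actHom, map_actHom, Category.assoc, ← f.w, ← Category.assoc,
    ← Category.assoc, cancel_mono] at map_naturality
  exact eq_conj_eqToHom _ _ map_naturality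

theorem actHom_lam (a : A) : c.actHom ((lam F).obj a) = eqToHom (c.act_obj_lam a) :=
  (over_hom_eq (c.lift_id a)).trans (Category.comp_id _)

theorem lam_act : lam F ⋙ c.act = 𝟭 A := by
  refine CategoryTheory.Functor.ext c.act_obj_lam fun a b f => ?_
  have naturality : c.act.map ((lam F).map f) ≫ c.actHom ((lam F).obj b) =
    c.actHom ((lam F).obj a) ≫ f := c.act_naturality ((lam F).map f)
  rw [actHom_lam, actHom_lam] at naturality
  exact eq_conj_eqToHom _ _ naturality

theorem mul_act : mul F ⋙ c.act = PathObj.map (H := c.act) (K := 𝟭 B) c.act_proj ⋙ c.act := by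
  refine (square_of_natural (s := mul F) (s' := c.act) (liftHom_naturality lam_mul')
    c.act_naturality (H := c.act) (K := 𝟭 B) c.act_proj c.act_obj_mul fun Q => ?_).symm
  have naturality := c.act_naturality (liftHom (lam_mul' (F := F)) Q)
  rw [liftHom_mul_pt] at naturality
  refine (cancel_mono (c.actHom Q.pt)).1 ?_
  exact (naturality.trans (Category.comp_id _)).trans
    ((over_hom_eq (c.lift_comp Q.pt.pt Q.iso Q.pt.iso)).trans (Category.assoc _ _ _).symm)

theorem ofAlg_act : ofAlg c.act c.act_proj c.lam_act c.mul_act = c := by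
  refine ext_lift fun a b x => ?_
  have naturality := c.act_naturality (toLam (⟨b, a, x⟩ : PathObj F))
  rw [toLam_pt, actHom_lam] at naturality
  exact congrArg Over.mk (naturality.trans (Category.comp_id _))

end SplitCleavage

end Cleavages

section Comparison

variable (X : grpdAWFS.{u}.RAlg)

/-- The action of an algebra. -/
def algAct : PathObj (A := X.A.left) (B := X.A.right) X.A.hom ⥤ X.A.left := X.a.left

theorem algebra_right_eq_id : X.a.right = 𝟙 X.A.right :=
  (Category.id_comp _).symm.trans (congrArg CommaMorphism.right X.unit)

theorem algAct_proj : algAct X ⋙ X.A.hom =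
    PathObj.baseFunctor (A := X.A.left) (B := X.A.right) X.A.hom := by
  have w : X.a.left ≫ X.A.hom = grpdAWFS.rho.app X.A ≫ X.a.right := X.a.w
  exact w.trans ((congrArg (grpdAWFS.rho.app X.A ≫ ·) (algebra_right_eq_id X)).trans
    (Category.comp_id (grpdAWFS.rho.app X.A)))

theorem lam_algAct : PathObj.lam (A := X.A.left) (B := X.A.right) X.A.hom ⋙ algAct X =
    𝟭 X.A.left := congrArg CommaMorphism.left X.unit

theorem mul_algAct : PathObj.mul (A := X.A.left) (B := X.A.right) X.A.hom ⋙ algAct X =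
    PathObj.map (H := algAct X) (K := 𝟭 X.A.right) (algAct_proj X) ⋙ algAct X :=
  (congrArg CommaMorphism.left X.assoc).trans
    (congrArg (· ⋙ algAct X) (PathObj.map_congr (A := grpdAWFS.M.obj X.A) (B := X.A.right)
      (A' := X.A.left) (B' := X.A.right) (algebra_right_eq_id X) X.a.w))

/-- The split cloven isofibration of an algebra. -/
def toSplitIsofibObj : SplitIsofib.{u} where
  arrow := X.A
  cleavage := SplitCleavage.ofAlg (A := X.A.left) (B := X.A.right) (algAct X) (algAct_proj X)
    (lam_algAct X) (mul_algAct X)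

theorem preserves_of_hom {X X' : grpdAWFS.{u}.RAlg} (φ : X ⟶ X') :
    SplitIsofib.Preserves (toSplitIsofibObj X) (toSplitIsofibObj X') φ.f := fun a b x =>
  over_mk_congr _ (map_liftHom_of_square (lam_algAct X) (lam_algAct X') (H := φ.f.left)
    (K := φ.f.right) φ.f.w (congrArg Arrow.Hom.left φ.h) ⟨b, a, x⟩)

theorem hom_of_preserves {X X' : grpdAWFS.{u}.RAlg} (s : X.A ⟶ X'.A)
    (h : SplitIsofib.Preserves (toSplitIsofibObj X) (toSplitIsofibObj X') s) :
    grpdAWFS.monadR.map s ≫ X'.a = X.a ≫ s := by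
  ext
  · exact square_of_natural (liftHom_naturality (lam_algAct X)) (liftHom_naturality (lam_algAct X'))
      (H := s.left) (K := s.right) s.w
      (fun P => congrArg (fun z : Over _ => z.left) (h P.pt P.iso))
      fun P => over_hom_eq (h P.pt P.iso)
  · exact (congrArg (s.right ≫ ·) (algebra_right_eq_id X')).trans
      ((Category.comp_id s.right).trans ((Category.id_comp s.right).symm.trans
        (congrArg (· ≫ s.right) (algebra_right_eq_id X)).symm))

/-- The comparison from algebras to split cloven isofibrations. -/
def toSplitIsofib : grpdAWFS.{u}.RAlg ⥤ SplitIsofib.{u} where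
  obj X := toSplitIsofibObj X
  map φ := ⟨φ.f, preserves_of_hom φ⟩
  map_id _ := rfl
  map_comp _ _ := rfl

instance : toSplitIsofib.{u}.Faithful where
  map_injective h := Monad.Algebra.Hom.ext (congrArg Subtype.val h)

instance : toSplitIsofib.{u}.Full where
  map_surjective s := ⟨⟨s.1, hom_of_preserves s.1 s.2⟩, rfl⟩

/-- The algebra of a split cloven isofibration. -/
def ofSplitIsofib (P : SplitIsofib.{u}) : grpdAWFS.{u}.RAlg where
  A := P.arrow
  a := Arrow.homMk (f := grpdAWFS.monadR.obj P.arrow) P.cleavage.act (𝟙 _)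
    (P.cleavage.act_proj.trans (Category.comp_id (grpdAWFS.rho.app P.arrow)).symm)
  unit := by
    ext
    · exact P.cleavage.lam_act
    · exact Category.comp_id _
  assoc := by
    ext
    · exact P.cleavage.mul_act
    · rfl

theorem toSplitIsofib_ofSplitIsofib (P : SplitIsofib.{u}) :
    toSplitIsofib.obj (ofSplitIsofib P) = P :=
  congrArg (SplitIsofib.mk P.arrow) P.cleavage.ofAlg_act

instance : toSplitIsofib.{u}.EssSurj where
  mem_essImage P := ⟨ofSplitIsofib P, ⟨eqToIso (toSplitIsofib_ofSplitIsofib P)⟩⟩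

instance : toSplitIsofib.{u}.IsEquivalence where

end Comparison

end ElemFib

theorem corollary5p5 :
    ElemFib.IsElementary ElemFib.grpdAWFS.{u}.algFunctor ∧
      ∃ e : ElemFib.grpdAWFS.{u}.RAlg ≌ ElemFib.SplitIsofib.{u},
        e.functor ⋙ ElemFib.SplitIsofib.forget = ElemFib.grpdAWFS.{u}.monadR.forget := by
  exact ⟨ElemFib.isElementary_algFunctor, ElemFib.toSplitIsofib.asEquivalence, rfl⟩
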